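/- Let $q=e^{2\pi i\tau}$ with $\operatorname{Im}\tau>0$ and let $z=e^{2\pi i w}$ with $w\in\mathbb{C}$; fractional powers mean $q^{a}=e^{2\pi i a\tau}$ and $z^{a}=e^{2\pi i a w}$. Put $(x;q)_\infty=\prod_{i\ge 0}(1-q^i x)$, $(q)_\infty=(q;q)_\infty$, $j(x;q)=(x;q)_\infty(q/x;q)_\infty(q;q)_\infty$, and let $$m(x,z;q)=\frac{1}{j(z;q)}\sum_{k\in\mathbb{Z}}\frac{(-1)^k q^{\binom{k}{2}}z^k}{1-q^{k-1}xz}$$ be the Appell function. For coprime integers $p\ge 1$, $p'\ge 2$ put $N=p'/p-2$, let $\Theta_{n,m}(z;q)=\sum_{k\in\mathbb{Z}+n/2m}q^{mk^2}z^{-mk}$, and let $$\chi_\ell^{(p,p')}(z;q)=\frac{\Theta_{\ell+1,p'}(z;q^p)-\Theta_{-(\ell+1),p'}(z;q^p)}{\Theta_{1,2}(z;q)-\Theta_{-1,2}(z;q)}$$ be the $A_1^{(1)}$-character of level $N$ and spin $\ell$, where $\Theta_{n,m}(z;q^p)$ is taken with $q^p=e^{2\pi i p\tau}$. Let the string functions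 $C_{m,\ell}^{(p,p')}(q)$ be the coefficients of the Laurent expansion $$\chi_\ell^{(p,p')}(z;q)=\sum_{m\in 2\mathbb{Z}+\ell}C_{m,\ell}^{(p,p')}(q)\,q^{\frac{m^2}{4N}}z^{-\frac m2}\qquad (|q|<|z|<1).$$ Let $(p,p')=(p,2p+1)$ with $p\ge 1$, and let $r$ be an integer (in particular, $r$ may be any of the admissible values $0\le r\le p-1$). Then, for all $z$ as above with $z\ne q^n$ for all $n\in\mathbb{Z}$ and, if $p\ge 2$, also $z\ne -q^{2pn}$ for all $n\in\mathbb{Z}$ (so that no denominator below or in the definition of $\chi$ vanishes), $$\begin{aligned} \chi_{2r+1}^{(p,2p+1)}(z;q) &= z^{-\frac12}q^{\frac p4}C_{1,2r+1}^{(p,2p+1)}(q)\,j(-z;q^{2p})\\ &\quad+\frac{1}{(q)_\infty^3}(-1)^p q^{-\frac18+\frac{p(2r+2)^2}{4(2p+1)}}q^{\binom p2-pr}z^{-\frac12}j(-z;q^{2p})\sum_{m=1}^{p-1}(-1)^m q^{\binom{m+1}{2}+m(r-p)}\\ &\qquad\times\Big(j(-q^{m(2p+1)+p(2r+2)};q^{2p(2p+1)})-q^{m(2p+1)-m(2r+2)}j(-q^{-m(2p+1)+p(2r+2)};q^{2p(2p+1)})\Big)\\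 &\qquad\times\Big(q^{m-p}\,m(-q^{m-p},-q^{2p}z^{-1};q^{2p})+m(-q^{m+p},-z;q^{2p})\Big). \end{aligned}$$ -/

import Mathlib

namespace PolarFinite

noncomputable section

/-- For `x = exp (2πi u)`, the power `x ^ a`, with the branch fixed by `u`. In particular
`ePow u 1 = x`. It is applied to the nome `q = exp (2πi τ)` and to `z = exp (2πi w)`; every
nonzero complex number `z`, together with every choice of the square root of `z`, arises from
some `w`. -/
def ePow (u a : ℂ) : ℂ := Complex.exp (2 * Real.pi * Complex.I * a * u)

/-- The infinite `q`-Pochhammer symbol `(x; q)_∞ = ∏_{i ≥ 0} (1 - q^i x)`. -/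
def qPoch (x q : ℂ) : ℂ := ∏' i : ℕ, (1 - q ^ i * x)

/-- The theta function `j(x; q) = (x; q)_∞ (q / x; q)_∞ (q; q)_∞`. -/
def thetaJ (x q : ℂ) : ℂ := qPoch x q * qPoch (q / x) q * qPoch q q

/-- The Appell function
`m(x, z; q) = j(z; q)⁻¹ ∑_{r ∈ ℤ} (-1)^r q^{r(r-1)/2} z^r / (1 - q^{r-1} x z)`.
The integer division `r * (r - 1) / 2` is exact. -/
def appellM (x z q : ℂ) : ℂ :=
  (1 / thetaJ z q) *
    ∑' r : ℤ, (-1) ^ r * q ^ (r * (r - 1) / 2) * z ^ r / (1 - q ^ (r - 1) * x * z)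

/-- The theta function `Θ_{n,m}(z; q) = ∑_{j ∈ ℤ + n/2m} q^{m j²} z^{-m j}`
with `z = exp (2πi w)`, `q = exp (2πi τ)`. -/
def bigTheta (n : ℤ) (m : ℕ) (w τ : ℂ) : ℂ :=
  ∑' k : ℤ, ePow τ (m * ((k : ℂ) + n / (2 * m)) ^ 2) * ePow w (-(m * ((k : ℂ) + n / (2 * m))))

/-- The `A₁⁽¹⁾` character `χ_ℓ^{(p,p')}(z; q)` of level `p'/p - 2` and spin `ℓ`, as given by the
Weyl--Kac formula, with `z = exp (2πi w)`, `q = exp (2πi τ)`. The theta functions in the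
numerator are taken at the nome `q ^ p = exp (2πi p τ)`. -/
def character (p p' : ℕ) (l : ℤ) (w τ : ℂ) : ℂ :=
  (bigTheta (l + 1) p' w (p * τ) - bigTheta (-(l + 1)) p' w (p * τ)) /
    (bigTheta 1 2 w τ - bigTheta (-1) 2 w τ)

/-- The admissible level `N = p'/p - 2`. -/
def level (p p' : ℕ) : ℂ := (p' : ℂ) / p - 2

/-- The string function `C_{m,ℓ}^N(q)`, for `m ≡ ℓ mod 2`, defined by
`χ_ℓ^N(z; q) = ∑_{m ∈ 2ℤ+ℓ} C_{m,ℓ}^N(q) q^{m²/4N} z^{-m/2}`: the coefficient in this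
Laurent expansion is extracted by integrating over the circle `|z| = |q|^{1/2}`, that is
`z = exp (2πi w)` with `w = x + τ/2`, `0 ≤ x ≤ 1`. (The character has no pole for
`|q| < |z| < |q|⁻¹`: its singularity at `z = 1` is removable.) -/
def stringFunction (p p' : ℕ) (m l : ℤ) (τ : ℂ) : ℂ :=
  ePow τ (-((m : ℂ) ^ 2 / (4 * level p p'))) *
    ∫ x in (0 : ℝ)..1, character p p' l (x + τ / 2) τ * ePow (x + τ / 2) ((m : ℂ) / 2)

theorem ePow_add (u a b : ℂ) : ePow u (a + b) = ePow u a * ePow u b := by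
  unfold ePow
  rw [← Complex.exp_add]
  congr 1
  ring

theorem ePow_zero (u : ℂ) : ePow u 0 = 1 := by simp [ePow]

theorem integral_ePow_int (τ : ℂ) (n : ℤ) :
    ∫ x in (0 : ℝ)..1, ePow (x + τ / 2) n = if n = 0 then 1 else 0 := by
  split_ifs with h
  · subst h
    simp [ePow_zero]
  · have hc : (2 * Real.pi * Complex.I * n : ℂ) ≠ 0 := by
      simp [h, Real.pi_ne_zero]
    have : ∀ x : ℝ, ePow (x + τ / 2) n =
        Complex.exp (2 * Real.pi * Complex.I * n * x) *
          Complex.exp (2 * Real.pi * Complex.I * n * (τ / 2)) := by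
      intro x
      rw [ePow, ← Complex.exp_add]
      congr 1
      ring
    simp_rw [this]
    rw [intervalIntegral.integral_mul_const, integral_exp_mul_complex hc]
    have : Complex.exp (2 * Real.pi * Complex.I * n * (1 : ℝ)) = 1 := by
      rw [← Complex.exp_int_mul_two_pi_mul_I n]
      congr 1
      push_cast
      ring
    simp only [this, Complex.ofReal_zero, mul_zero, Complex.exp_zero, sub_self, zero_div, zero_mul]

/-- The coefficients of any expansion `χ_ℓ^N(z; q) = ∑_{m ∈ 2ℤ+ℓ} C_m q^{m²/4N} z^{-m/2}` on the
circle `|z| = |q|^{1/2}` are the string functions. -/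
theorem stringFunction_eq_of_hasSum (p p' : ℕ) (l : ℤ) (τ : ℂ) (C : ℤ → ℂ)
    (hC : ∀ x : ℝ, HasSum (fun k : ℤ =>
      C (2 * k + l) * ePow τ (((2 * k + l : ℤ) : ℂ) ^ 2 / (4 * level p p')) *
        ePow (x + τ / 2) (-(((2 * k + l : ℤ) : ℂ) / 2)))
      (character p p' l (x + τ / 2) τ)) (k : ℤ) :
    C (2 * k + l) = stringFunction p p' (2 * k + l) l τ := by
  set D : ℤ → ℂ := fun n =>
    C (2 * n + l) * ePow τ (((2 * n + l : ℤ) : ℂ) ^ 2 / (4 * level p p')) with hD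
  have hterm : ∀ (x : ℝ) (n : ℤ),
      D n * ePow (x + τ / 2) (-(((2 * n + l : ℤ) : ℂ) / 2)) *
        ePow (x + τ / 2) (((2 * k + l : ℤ) : ℂ) / 2) =
      D n * ePow (x + τ / 2) ((k - n : ℤ) : ℂ) := by
    intro x n
    rw [mul_assoc, ← ePow_add]
    congr 2
    push_cast
    ring
  have hsum : ∀ x : ℝ, HasSum (fun n : ℤ => D n * ePow (x + τ / 2) ((k - n : ℤ) : ℂ))
      (character p p' l (x + τ / 2) τ * ePow (x + τ / 2) (((2 * k + l : ℤ) : ℂ) / 2)) := by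
    intro x
    have := (hC x).mul_right (ePow (x + τ / 2) (((2 * k + l : ℤ) : ℂ) / 2))
    refine this.congr_fun ?_
    intro n
    exact (hterm x n).symm
  have hnorm : ∀ (x : ℝ) (n : ℤ),
      ‖D n * ePow (x + τ / 2) ((k - n : ℤ) : ℂ)‖ = ‖D n * ePow (τ / 2) ((k - n : ℤ) : ℂ)‖ := by
    intro x n
    have : ‖ePow (x + τ / 2) ((k - n : ℤ) : ℂ)‖ = ‖ePow (τ / 2) ((k - n : ℤ) : ℂ)‖ := by
      unfold ePow
      rw [Complex.norm_exp, Complex.norm_exp]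
      congr 1
      simp
    rw [norm_mul (D n), norm_mul (D n), this]
  have hsm : Summable (fun n : ℤ => ‖D n * ePow (τ / 2) ((k - n : ℤ) : ℂ)‖) := by
    have := (hsum 0).summable.norm
    simpa using this
  have hcont : ∀ n : ℤ, Continuous (fun x : ℝ => D n * ePow (x + τ / 2) ((k - n : ℤ) : ℂ)) := by
    intro n
    unfold ePow
    fun_prop
  have key := intervalIntegral.hasSum_integral_of_dominated_convergence
    (μ := MeasureTheory.volume) (a := 0) (b := 1)
    (F := fun (n : ℤ) (x : ℝ) => D n * ePow (x + τ / 2) ((k - n : ℤ) : ℂ))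
    (f := fun x : ℝ => character p p' l (x + τ / 2) τ *
      ePow (x + τ / 2) (((2 * k + l : ℤ) : ℂ) / 2))
    (fun n _ => ‖D n * ePow (τ / 2) ((k - n : ℤ) : ℂ)‖)
    (fun n => (hcont n).aestronglyMeasurable)
    (fun n => Filter.Eventually.of_forall fun x _ => (hnorm x n).le)
    (Filter.Eventually.of_forall fun x _ => hsm)
    (by simp)
    (Filter.Eventually.of_forall fun x _ => hsum x)
  have hint : (fun n : ℤ => ∫ x in (0 : ℝ)..1, D n * ePow (x + τ / 2) ((k - n : ℤ) : ℂ)) =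
      fun n => if n = k then D k else 0 := by
    funext n
    rw [intervalIntegral.integral_const_mul, integral_ePow_int]
    by_cases h : n = k
    · simp [h]
    · have : k - n ≠ 0 := fun h' => h (by omega)
      simp [h, this]
  rw [hint] at key
  have hval := key.unique (hasSum_ite_eq k (D k))
  unfold stringFunction
  rw [hval, hD]
  dsimp only
  rw [mul_left_comm, ← ePow_add, neg_add_cancel, ePow_zero, mul_one]

end

end PolarFinite

/-!
Multiplying the character by `z^{1/2}` gives a function of `z` alone: by the triple product
identity the Weyl--Kac denominator is `q^{1/8} z^{-1/2} j(z; q)`, and the numerator is a combination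
of theta functions in integral powers of `z`. At level `1 / p` this function,
`shiftedCharacter`, is multiplied by `z^{-1}` under `z ↦ q^{2p} z`, as is `j(-z; q^{2p})`. Its
only possible singularities are simple poles at the points `z = q^n`. Since the numerator is odd
under `z ↦ z⁻¹`, the poles at `n ≡ 0` and `n ≡ p` modulo `2p` are absent, and the residues at `q^n`
and `q^{-n}` determine each other.

The sums `polarSum`, which are the combinations of Appell functions in the theorem multiplied by
`j(-z; q^{2p})`, have the same multiplier, and their poles lie at `q^{p-m}` and `q^{m-p}` modulo
`q^{2p}`. Matching the residues (`sum_polarCoeff`) therefore leaves a function with only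
removable singularities, hence an entire function of `w`. Such a function satisfies a first-order
recursion on its Fourier coefficients, so that it vanishes as soon as its zeroth coefficient does
(`eq_zero_of_quasiperiodic`). On the circle `|z| = |q|^{1/2}` the zeroth coefficient of
`j(-z; q^{2p})` is `1`, that of each `polarSum` is `0` (`integral_polarSum`), and that of
`shiftedCharacter` is a string function up to a power of `q` (`stringFunction_one_eq`). This is the
decomposition `shiftedCharacter_eq`. It remains to write the residues in terms of theta functions,
which is again the triple product identity, applied to the numerator at `z = q^{p-m}`
(`weylNumerator_int_mul`).

The triple product identity is obtained as the limit of its finite form, which is the `q`-binomial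
theorem. The numerators of the Appell functions converge for all `z` off their poles, so that they
can be handled term by term.
-/

namespace PolarFinite

open Filter Topology Complex

/-! ### Exponentials and powers -/

/-- The exponential `exp (2πi u)`, which turns the additive variables `τ`, `w` into the
multiplicative variables `q`, `z`. -/
noncomputable def nome (u : ℂ) : ℂ := cexp (2 * Real.pi * I * u)

theorem ePow_eq_nome (u a : ℂ) : ePow u a = nome (a * u) := by
  unfold ePow nome; congr 1; ring

theorem nome_add (u v : ℂ) : nome (u + v) = nome u * nome v := by
  unfold nome; rw [← Complex.exp_add]; congr 1; ring

theorem nome_ne_zero (u : ℂ) : nome u ≠ 0 := Complex.exp_ne_zero _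

@[simp] theorem nome_zero : nome 0 = 1 := by simp [nome]

@[simp] theorem nome_one : nome 1 = 1 := by simp [nome, Complex.exp_two_pi_mul_I]

theorem nome_neg (u : ℂ) : nome (-u) = (nome u)⁻¹ := by
  unfold nome; rw [← Complex.exp_neg]; congr 1; ring

theorem nome_sub (u v : ℂ) : nome (u - v) = nome u / nome v := by
  rw [sub_eq_add_neg, nome_add, nome_neg, div_eq_mul_inv]

theorem nome_int_mul (n : ℤ) (u : ℂ) : nome (n * u) = nome u ^ n := by
  unfold nome; rw [← Complex.exp_int_mul]; congr 1; ring

theorem nome_nat_mul (n : ℕ) (u : ℂ) : nome (n * u) = nome u ^ n := by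
  simpa using nome_int_mul n u

@[simp] theorem nome_int (n : ℤ) : nome n = 1 := by
  have := nome_int_mul n 1; simpa using this

theorem nome_half : nome (1 / 2) = -1 := by
  unfold nome; rw [← Complex.exp_pi_mul_I]; congr 1; ring

theorem nome_int_div_two (n : ℤ) : nome (n / 2) = (-1) ^ n := by
  rw [← nome_half, ← nome_int_mul]; congr 1; ring

theorem nome_add_int (u : ℂ) (n : ℤ) : nome (u + n) = nome u := by
  rw [nome_add, nome_int, mul_one]

theorem nome_add_half (u : ℂ) : nome (u + 1 / 2) = -nome u := by
  rw [nome_add, nome_half]; ring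

theorem norm_nome (u : ℂ) : ‖nome u‖ = Real.exp (-(2 * Real.pi * u.im)) := by
  unfold nome; rw [Complex.norm_exp]; congr 1; simp

theorem norm_nome_lt_one {τ : ℂ} (hτ : 0 < τ.im) : ‖nome τ‖ < 1 := by
  rw [norm_nome, Real.exp_lt_one_iff]
  have := Real.pi_pos
  have : 0 < 2 * Real.pi * τ.im := by positivity
  linarith

theorem nome_eq_one_iff (u : ℂ) : nome u = 1 ↔ ∃ n : ℤ, u = n := by
  unfold nome
  rw [Complex.exp_eq_one_iff]
  have h : (2 * Real.pi * I : ℂ) ≠ 0 := Complex.two_pi_I_ne_zero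
  refine exists_congr fun n => ⟨fun hn => ?_, fun hn => ?_⟩
  · apply mul_left_cancel₀ h; rw [hn]; ring
  · rw [hn]; ring

theorem nome_eq_nome_iff (u v : ℂ) : nome u = nome v ↔ ∃ n : ℤ, u = v + n := by
  rw [← div_eq_one_iff_eq (nome_ne_zero v), ← nome_sub, nome_eq_one_iff]
  exact exists_congr fun n => sub_eq_iff_eq_add'

theorem exists_nome_eq {x : ℂ} (hx : x ≠ 0) : ∃ u, nome u = x := by
  refine ⟨Complex.log x / (2 * Real.pi * I), ?_⟩
  unfold nome
  rw [mul_div_cancel₀ _ Complex.two_pi_I_ne_zero, Complex.exp_log hx]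

theorem differentiable_nome : Differentiable ℂ nome := by
  unfold nome; fun_prop

theorem continuous_nome : Continuous nome := differentiable_nome.continuous

theorem two_mul_triangle (k : ℤ) : 2 * (k * (k - 1) / 2) = k * (k - 1) := by
  apply Int.mul_ediv_cancel'
  exact (Int.even_mul_pred_self k).two_dvd

theorem triangle_cast (k : ℤ) : ((k * (k - 1) / 2 : ℤ) : ℂ) = k * (k - 1) / 2 := by
  have h := two_mul_triangle k
  have : ((2 * (k * (k - 1) / 2) : ℤ) : ℂ) = ((k * (k - 1) : ℤ) : ℂ) := by rw [h]
  push_cast at this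
  linear_combination this / 2

theorem choose_two_cast (n : ℕ) : ((n.choose 2 : ℕ) : ℤ) = (n : ℤ) * (n - 1) / 2 := by
  have h' := Nat.choose_two_right n
  rcases n with _ | n
  · simp
  · rw [h', Nat.add_sub_cancel]; push_cast; simp

theorem triangle_succ (k : ℤ) : (k + 1) * (k + 1 - 1) / 2 = k * (k - 1) / 2 + k := by
  have h := two_mul_triangle k
  have h' := two_mul_triangle (k + 1)
  have : (k + 1) * (k + 1 - 1) = k * (k - 1) + 2 * k := by ring
  omega

/-! ### The `q`-binomial theorem -/

/-- The finite product `(q; q)_n`. -/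
noncomputable def qFactorial (q : ℂ) (n : ℕ) : ℂ := ∏ i ∈ Finset.range n, (1 - q ^ i * q)

/-- The Gaussian binomial coefficient, given by its Pascal recursion. -/
noncomputable def gaussBinom (q : ℂ) : ℕ → ℕ → ℂ
  | _, 0 => 1
  | 0, _ + 1 => 0
  | n + 1, j + 1 => gaussBinom q n (j + 1) + q ^ (n - j) * gaussBinom q n j

theorem gaussBinom_zero_right (q : ℂ) (n : ℕ) : gaussBinom q n 0 = 1 := by
  cases n <;> rfl

theorem gaussBinom_of_lt (q : ℂ) {n j : ℕ} (h : n < j) : gaussBinom q n j = 0 := by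
  induction n generalizing j with
  | zero => cases j with
    | zero => omega
    | succ j => rfl
  | succ n ih => cases j with
    | zero => omega
    | succ j => rw [gaussBinom, ih (by omega), ih (by omega)]; ring

theorem gaussBinom_self (q : ℂ) (n : ℕ) : gaussBinom q n n = 1 := by
  induction n with
  | zero => rfl
  | succ n ih => rw [gaussBinom, gaussBinom_of_lt q (by omega), ih]; simp

theorem gaussBinom_mul_qFactorial (q : ℂ) (a b : ℕ) :
    gaussBinom q (a + b) a * (qFactorial q a * qFactorial q b) = qFactorial q (a + b) := by
  induction h : a + b generalizing a b with
  | zero =>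
    obtain ⟨rfl, rfl⟩ : a = 0 ∧ b = 0 := by omega
    simp [gaussBinom, qFactorial]
  | succ n ih =>
    rcases a with _ | a
    · obtain rfl : b = n + 1 := by omega
      rw [gaussBinom_zero_right]; simp [qFactorial]
    rcases b with _ | b
    · obtain rfl : a = n := by omega
      rw [gaussBinom_self]; simp [qFactorial]
    have e1 := ih (a + 1) b (by omega)
    have e2 := ih a (b + 1) (by omega)
    have hn : n - a = b + 1 := by omega
    rw [gaussBinom, hn]
    have ha : qFactorial q (a + 1) = qFactorial q a * (1 - q ^ a * q) := Finset.prod_range_succ _ _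
    have hb : qFactorial q (b + 1) = qFactorial q b * (1 - q ^ b * q) := Finset.prod_range_succ _ _
    have hn' : qFactorial q (n + 1) = qFactorial q n * (1 - q ^ n * q) := Finset.prod_range_succ _ _
    have hq : q ^ n = q ^ a * q ^ b * q := by
      rw [show n = a + b + 1 by omega]; ring
    rw [hn', hq]
    rw [hb] at e2 ⊢
    rw [ha] at e1 ⊢
    linear_combination (1 - q ^ b * q) * e1 + q ^ (b + 1) * (1 - q ^ a * q) * e2

/-- The `q`-binomial theorem. -/
theorem prod_one_add_pow_mul (q y : ℂ) (n : ℕ) :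
    ∏ i ∈ Finset.range n, (1 + q ^ i * y) =
      ∑ j ∈ Finset.range (n + 1), gaussBinom q n j * q ^ (j.choose 2) * y ^ j := by
  induction n with
  | zero => simp [gaussBinom]
  | succ n ih =>
    rw [Finset.prod_range_succ, ih, Finset.sum_range_succ' _ (n + 1)]
    have h1 : ∑ j ∈ Finset.range (n + 1), gaussBinom q n j * q ^ (j.choose 2) * y ^ j =
        ∑ j ∈ Finset.range (n + 1),
          gaussBinom q n (j + 1) * q ^ ((j + 1).choose 2) * y ^ (j + 1) + 1 := by
      have := Finset.sum_range_succ' (fun j => gaussBinom q n j * q ^ (j.choose 2) * y ^ j) (n + 1)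
      rw [Finset.sum_range_succ, gaussBinom_of_lt q (Nat.lt_succ_self n)] at this
      simpa [gaussBinom_zero_right] using this
    rw [mul_add, mul_one]
    nth_rw 1 [h1]
    rw [Finset.sum_mul]
    simp only [gaussBinom_zero_right, Nat.choose_zero_succ, pow_zero, mul_one]
    rw [add_right_comm, ← Finset.sum_add_distrib]
    congr 1
    refine Finset.sum_congr rfl fun j hj => ?_
    have hj' : j ≤ n := by simpa [Nat.lt_succ_iff] using hj
    have hc : (j + 1).choose 2 = j + j.choose 2 := by
      rw [Nat.choose_succ_succ' j 1, Nat.choose_one_right]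
    have hq : q ^ n = q ^ (n - j) * q ^ j := by rw [← pow_add]; congr 1; omega
    rw [gaussBinom, hc, hq]
    ring

/-- The finite form of the Jacobi triple product identity. It is the `q`-binomial theorem for
`∏_{i < 2n} (1 - q^{i-n} x)`, whose first half is reflected into powers of `q / x`. -/
theorem finite_triple_product {q x : ℂ} (hq : q ≠ 0) (hx : x ≠ 0) (n : ℕ) :
    (∏ i ∈ Finset.range n, (1 - q ^ i * x)) * ∏ i ∈ Finset.range n, (1 - q ^ i * (q / x)) =
      ∑ k ∈ Finset.Icc (-n : ℤ) n,
        gaussBinom q (2 * n) (n + k).toNat * ((-1) ^ k * q ^ (k * (k - 1) / 2) * x ^ k) := by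
  have key := prod_one_add_pow_mul q (-x * (q ^ n)⁻¹) (2 * n)
  rw [two_mul, Finset.prod_range_add] at key
  have hsecond : ∏ i ∈ Finset.range n, (1 + q ^ (n + i) * (-x * (q ^ n)⁻¹)) =
      ∏ i ∈ Finset.range n, (1 - q ^ i * x) := by
    refine Finset.prod_congr rfl fun i _ => ?_
    rw [pow_add]; field_simp; ring
  have hfirst : (∏ i ∈ Finset.range n, (-(q ^ i * (q / x)))) *
      ∏ i ∈ Finset.range n, (1 + q ^ i * (-x * (q ^ n)⁻¹)) =
      ∏ i ∈ Finset.range n, (1 - q ^ i * (q / x)) := by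
    rw [← Finset.prod_range_reflect (fun i => 1 + q ^ i * (-x * (q ^ n)⁻¹)),
      ← Finset.prod_mul_distrib]
    refine Finset.prod_congr rfl fun i hi => ?_
    have hi' : n = (n - 1 - i) + (i + 1) := by
      have := Finset.mem_range.mp hi; omega
    have : q ^ (n - 1 - i) * (q ^ n)⁻¹ = (q ^ (i + 1))⁻¹ := by
      nth_rw 2 [hi']
      rw [pow_add]; field_simp
    rw [show q ^ (n - 1 - i) * (-x * (q ^ n)⁻¹) = -x * (q ^ (n - 1 - i) * (q ^ n)⁻¹) by ring, this]
    field_simp; ring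
  have hpref : ∏ i ∈ Finset.range n, (-(q ^ i * (q / x))) =
      (-1) ^ n * q ^ ((n + 1).choose 2) * (x ^ n)⁻¹ := by
    clear hsecond hfirst key
    induction n with
    | zero => simp
    | succ n ih =>
      have hc : (n + 1 + 1).choose 2 = n + 1 + (n + 1).choose 2 := by
        rw [Nat.choose_succ_succ' (n + 1) 1, Nat.choose_one_right]
      rw [Finset.prod_range_succ, ih, hc]
      field_simp
      ring
  rw [← hfirst, hpref, mul_comm, mul_assoc, ← hsecond, key, Finset.mul_sum]
  symm
  refine Finset.sum_bij' (fun k _ => (n + k).toNat) (fun j _ => (j : ℤ) - n) ?_ ?_ ?_ ?_ ?_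
  · intro k hk; simp only [Finset.mem_Icc, Finset.mem_range] at *; omega
  · intro j hj; simp only [Finset.mem_Icc, Finset.mem_range] at *; omega
  · intro k hk; simp only [Finset.mem_Icc] at *; omega
  · intro j hj; simp
  · intro k hk
    simp only [Finset.mem_Icc] at hk
    obtain ⟨j, hj⟩ : ∃ j : ℕ, (n : ℤ) + k = j := ⟨(n + k).toNat, by omega⟩
    have hk' : k = j - n := by omega
    subst hk'
    rw [hj, Int.toNat_natCast]
    have hE : (((n + 1).choose 2 : ℕ) : ℤ) + (j.choose 2 : ℕ) =
        ((j : ℤ) - n) * ((j : ℤ) - n - 1) / 2 + n * j := by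
      have h := two_mul_triangle ((j : ℤ) - n)
      have h1 := two_mul_triangle ((n : ℤ) + 1)
      have h2 := two_mul_triangle (j : ℤ)
      rw [choose_two_cast, choose_two_cast]
      push_cast
      linarith
    have hqE : q ^ (((j : ℤ) - n) * ((j : ℤ) - n - 1) / 2) =
        q ^ ((n + 1).choose 2) * q ^ (j.choose 2) * (q ^ (n * j))⁻¹ := by
      rw [eq_mul_inv_iff_mul_eq₀ (pow_ne_zero _ hq), ← zpow_natCast q (n * j),
        ← zpow_natCast q ((n + 1).choose 2), ← zpow_natCast q (j.choose 2), ← zpow_add₀ hq,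
        ← zpow_add₀ hq, hE]
      push_cast; rfl
    have hs : ((-1 : ℂ)) ^ ((j : ℤ) - n) = (-1) ^ n * (-1) ^ j := by
      rw [zpow_sub₀ (by norm_num), zpow_natCast, zpow_natCast, div_eq_mul_inv, ← inv_pow]
      norm_num [mul_comm]
    rw [hqE, hs, zpow_sub₀ hx, zpow_natCast, zpow_natCast, mul_pow, neg_pow x, inv_pow, ← pow_mul,
      two_mul]
    ring

/-! ### The Jacobi triple product identity -/

theorem summable_norm_pow_mul {q : ℂ} (hq : ‖q‖ < 1) (x : ℂ) :
    Summable fun i : ℕ => ‖-(q ^ i * x)‖ := by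
  simp only [norm_neg, norm_mul, norm_pow]
  exact (summable_geometric_of_lt_one (norm_nonneg _) hq).mul_right _

theorem hasProd_qPoch {q : ℂ} (hq : ‖q‖ < 1) (x : ℂ) :
    HasProd (fun i : ℕ => 1 - q ^ i * x) (qPoch x q) := by
  simp_rw [qPoch, sub_eq_add_neg]
  exact (multipliable_one_add_of_summable (summable_norm_pow_mul hq x)).hasProd

theorem qPoch_ne_zero {q x : ℂ} (hq : ‖q‖ < 1) (h : ∀ i : ℕ, q ^ i * x ≠ 1) :
    qPoch x q ≠ 0 := by
  simp_rw [qPoch, sub_eq_add_neg]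
  refine tprod_one_add_ne_zero_of_summable (fun i hi => h i ?_) (summable_norm_pow_mul hq x)
  linear_combination -hi

theorem qPoch_self_ne_zero {q : ℂ} (hq : ‖q‖ < 1) : qPoch q q ≠ 0 := by
  refine qPoch_ne_zero hq fun i hi => ?_
  have : ‖q ^ i * q‖ < 1 := by
    rw [← pow_succ, norm_pow]; exact pow_lt_one₀ (norm_nonneg _) hq (by omega)
  rw [hi] at this; simp at this

theorem qPoch_eq_one_sub_mul {q : ℂ} (hq : ‖q‖ < 1) (x : ℂ) :
    qPoch x q = (1 - x) * qPoch (q * x) q := by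
  have h' := (hasProd_qPoch hq (q * x)).multipliable
  rw [qPoch, tprod_eq_zero_mul' (by simpa [pow_succ, mul_assoc] using h'), qPoch]
  simp [pow_succ, mul_assoc]

theorem continuous_qPoch {q : ℂ} (hq : ‖q‖ < 1) : Continuous fun x => qPoch x q := by
  rw [continuous_iff_continuousAt]
  intro x₀
  have hu : Summable fun i : ℕ => ‖q‖ ^ i * (‖x₀‖ + 1) :=
    (summable_geometric_of_lt_one (norm_nonneg _) hq).mul_right _
  have hK := isCompact_closedBall x₀ 1
  have h := hu.hasProdUniformlyOn_nat_one_add (f := fun i x => -(q ^ i * x)) hK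
    (Eventually.of_forall fun i x hx => ?_) (fun i => by fun_prop)
  · rw [hasProdUniformlyOn_iff_tendstoUniformlyOn] at h
    have hc := h.continuousOn (Eventually.frequently (Eventually.of_forall fun s => by fun_prop))
    have := hc.continuousAt (Metric.closedBall_mem_nhds x₀ one_pos)
    simp only [← sub_eq_add_neg] at this
    exact this
  · rw [norm_neg, norm_mul, norm_pow]
    gcongr
    have : ‖x - x₀‖ ≤ 1 := by simpa [dist_eq_norm] using hx
    calc ‖x‖ = ‖x₀ + (x - x₀)‖ := by congr 1; ring
      _ ≤ ‖x₀‖ + 1 := (norm_add_le _ _).trans (by gcongr)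

theorem tendsto_qFactorial {q : ℂ} (hq : ‖q‖ < 1) :
    Tendsto (qFactorial q) atTop (𝓝 (qPoch q q)) :=
  (hasProd_qPoch hq q).tendsto_prod_nat

theorem qFactorial_ne_zero {q : ℂ} (hq : ‖q‖ < 1) (n : ℕ) : qFactorial q n ≠ 0 := by
  rw [qFactorial, Finset.prod_ne_zero_iff]
  intro i _ hi
  have : ‖q ^ i * q‖ < 1 := by
    rw [← pow_succ, norm_pow]; exact pow_lt_one₀ (norm_nonneg _) hq (by omega)
  rw [← sub_eq_zero.mp hi] at this; simp at this

theorem gaussBinom_eq_div {q : ℂ} (hq : ‖q‖ < 1) (a b : ℕ) :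
    gaussBinom q (a + b) a = qFactorial q (a + b) * (qFactorial q a)⁻¹ * (qFactorial q b)⁻¹ := by
  rw [← gaussBinom_mul_qFactorial]
  have := qFactorial_ne_zero hq a
  have := qFactorial_ne_zero hq b
  field_simp

theorem exists_norm_gaussBinom_le {q : ℂ} (hq : ‖q‖ < 1) :
    ∃ C : ℝ, 0 ≤ C ∧ ∀ a b, ‖gaussBinom q (a + b) a‖ ≤ C := by
  have h1 := tendsto_qFactorial hq
  have h2 := h1.inv₀ (qPoch_self_ne_zero hq)
  obtain ⟨M, hM⟩ := h1.norm.bddAbove_range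
  obtain ⟨M', hM'⟩ := h2.norm.bddAbove_range
  have hM : ∀ n, ‖qFactorial q n‖ ≤ M := fun n => hM ⟨n, rfl⟩
  have hM' : ∀ n, ‖(qFactorial q n)⁻¹‖ ≤ M' := fun n => hM' ⟨n, rfl⟩
  have h0 : 0 ≤ M := (norm_nonneg _).trans (hM 0)
  have h0' : 0 ≤ M' := (norm_nonneg _).trans (hM' 0)
  refine ⟨M * M' * M', by positivity, fun a b => ?_⟩
  rw [gaussBinom_eq_div hq, norm_mul, norm_mul]
  gcongr
  exacts [hM _, hM' _, hM' _]

/-- A fixed column of the Gaussian triangle, counted from its middle, tends to `1 / (q; q)_∞`. -/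
theorem tendsto_gaussBinom_central {q : ℂ} (hq : ‖q‖ < 1) (k : ℤ) :
    Tendsto (fun n : ℕ => gaussBinom q (2 * n) (n + k).toNat) atTop (𝓝 (qPoch q q)⁻¹) := by
  have h1 := tendsto_qFactorial hq
  have hne := qPoch_self_ne_zero hq
  have h2 := h1.inv₀ hne
  have ht : ∀ k : ℤ, Tendsto (fun n : ℕ => ((n : ℤ) + k).toNat) atTop atTop := by
    intro k
    refine tendsto_atTop.mpr fun b => ?_
    filter_upwards [eventually_ge_atTop (b + k.natAbs)] with n hn
    omega
  have ht2 : Tendsto (fun n : ℕ => 2 * n) atTop atTop :=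
    tendsto_id.const_mul_atTop' (by norm_num)
  have := ((h1.comp ht2).mul (h2.comp (ht k))).mul (h2.comp (ht (-k)))
  rw [mul_inv_cancel₀ hne, one_mul] at this
  refine this.congr' ?_
  filter_upwards [eventually_ge_atTop k.natAbs] with n hn
  have h : 2 * n = ((n : ℤ) + k).toNat + ((n : ℤ) + -k).toNat := by omega
  simp only [Function.comp_apply]
  rw [h, gaussBinom_eq_div hq]

/-- The term `(-1)^k q^{k(k-1)/2} x^k` is a term of the two-variable Jacobi theta series. -/
theorem jacobiTheta₂_term_eq (u τ : ℂ) (k : ℤ) :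
    jacobiTheta₂_term k (u + 1 / 2 - τ / 2) τ =
      (-1) ^ k * nome τ ^ (k * (k - 1) / 2) * nome u ^ k := by
  rw [← nome_int_div_two, ← nome_int_mul, ← nome_int_mul, ← nome_add, ← nome_add, triangle_cast,
    jacobiTheta₂_term, nome]
  congr 1
  ring

theorem summable_norm_theta_term {q x : ℂ} (hq₀ : q ≠ 0) (hq : ‖q‖ < 1) (hx : x ≠ 0) :
    Summable fun k : ℤ => ‖q ^ (k * (k - 1) / 2) * x ^ k‖ := by
  obtain ⟨τ, rfl⟩ := exists_nome_eq hq₀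
  obtain ⟨u, rfl⟩ := exists_nome_eq hx
  have hτ : 0 < τ.im := by
    by_contra! h
    rw [norm_nome, Real.exp_lt_one_iff] at hq
    have := Real.pi_pos
    nlinarith
  have := ((summable_jacobiTheta₂_term_iff (u + 1 / 2 - τ / 2) τ).mpr hτ).norm
  simp_rw [jacobiTheta₂_term_eq, norm_mul, norm_zpow, norm_neg, norm_one, one_zpow, one_mul] at this
  simpa only [norm_mul, norm_zpow] using this

/-- The Jacobi triple product identity: let `n` tend to infinity in its finite form. -/
theorem thetaJ_eq_tsum {q x : ℂ} (hq₀ : q ≠ 0) (hq : ‖q‖ < 1) (hx : x ≠ 0) :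
    thetaJ x q = ∑' k : ℤ, (-1) ^ k * q ^ (k * (k - 1) / 2) * x ^ k := by
  obtain ⟨C, hC₀, hC⟩ := exists_norm_gaussBinom_le hq
  set f : ℕ → ℤ → ℂ := fun n k => if k ∈ Finset.Icc (-n : ℤ) n then
    gaussBinom q (2 * n) (n + k).toNat * ((-1) ^ k * q ^ (k * (k - 1) / 2) * x ^ k) else 0 with hf
  have hlim : Tendsto (fun n => ∑' k, f n k) atTop
      (𝓝 (∑' k : ℤ, (qPoch q q)⁻¹ * ((-1) ^ k * q ^ (k * (k - 1) / 2) * x ^ k))) := by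
    refine tendsto_tsum_of_dominated_convergence
      (bound := fun k : ℤ => C * ‖q ^ (k * (k - 1) / 2) * x ^ k‖)
      ((summable_norm_theta_term hq₀ hq hx).mul_left C) (fun k => ?_)
      (Eventually.of_forall fun n k => ?_)
    · refine ((tendsto_gaussBinom_central hq k).mul_const _).congr' ?_
      filter_upwards [eventually_ge_atTop k.natAbs] with n hn
      rw [hf]
      simp only
      rw [if_pos]
      rw [Finset.mem_Icc]; omega
    · simp only [hf]
      split_ifs with h
      · rw [Finset.mem_Icc] at h
        have h2 : 2 * n = ((n : ℤ) + k).toNat + ((n : ℤ) + -k).toNat := by omega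
        rw [norm_mul, mul_assoc, norm_mul ((-1) ^ k), norm_zpow, norm_neg, norm_one, one_zpow,
          one_mul, h2]
        gcongr
        exact hC _ _
      · rw [norm_zero]; positivity
  have hsum : ∀ n, ∑' k, f n k =
      (∏ i ∈ Finset.range n, (1 - q ^ i * x)) * ∏ i ∈ Finset.range n, (1 - q ^ i * (q / x)) := by
    intro n
    rw [finite_triple_product hq₀ hx, tsum_eq_sum (s := Finset.Icc (-n : ℤ) n)]
    · exact Finset.sum_congr rfl fun k hk => if_pos hk
    · exact fun k hk => if_neg hk
  simp_rw [hsum] at hlim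
  have hlim' := (hasProd_qPoch hq x).tendsto_prod_nat.mul
    (hasProd_qPoch hq (q / x)).tendsto_prod_nat
  have := tendsto_nhds_unique hlim' hlim
  rw [tsum_mul_left] at this
  rw [thetaJ, this, mul_comm, mul_inv_cancel_left₀ (qPoch_self_ne_zero hq)]

theorem thetaJ_nome {τ : ℂ} (hτ : 0 < τ.im) (u : ℂ) :
    thetaJ (nome u) (nome τ) = jacobiTheta₂ (u + 1 / 2 - τ / 2) τ := by
  rw [thetaJ_eq_tsum (nome_ne_zero _) (norm_nome_lt_one hτ) (nome_ne_zero _), jacobiTheta₂]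
  simp_rw [jacobiTheta₂_term_eq]

/-! ### Zeros and quasi-periodicity of the theta function -/

theorem differentiable_thetaJ_nome {τ : ℂ} (hτ : 0 < τ.im) :
    Differentiable ℂ fun u => thetaJ (nome u) (nome τ) := by
  intro u
  simp_rw [thetaJ_nome hτ]
  have h := differentiableAt_jacobiTheta₂_fst (u + 1 / 2 - τ / 2) hτ
  exact DifferentiableAt.comp (f := fun u => u + 1 / 2 - τ / 2) u h (by fun_prop)

theorem thetaJ_div_self {q x : ℂ} (hq : q ≠ 0) :
    thetaJ (q / x) q = thetaJ x q := by
  rw [thetaJ, thetaJ, div_div_cancel₀ hq]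
  ring

theorem thetaJ_nome_add {τ : ℂ} (hτ : 0 < τ.im) (u : ℂ) :
    thetaJ (nome (u + τ)) (nome τ) = -nome (-u) * thetaJ (nome u) (nome τ) := by
  rw [thetaJ_nome hτ, thetaJ_nome hτ, show u + τ + 1 / 2 - τ / 2 = u + 1 / 2 - τ / 2 + τ by ring,
    jacobiTheta₂_add_left']
  congr 1
  rw [show -u = -u - 1 / 2 + 1 / 2 by ring, nome_add_half, neg_neg, nome]
  congr 1
  ring

theorem thetaJ_nome_neg {τ : ℂ} (hτ : 0 < τ.im) (u : ℂ) :
    thetaJ (nome (-u)) (nome τ) = -nome (-u) * thetaJ (nome u) (nome τ) := by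
  have h1 := thetaJ_nome_add hτ (-u)
  rw [neg_neg, show -u + τ = τ - u by ring, nome_sub, thetaJ_div_self (nome_ne_zero τ)] at h1
  have h2 : nome (-u) * nome u = 1 := by rw [← nome_add]; simp
  rw [h1]
  linear_combination -thetaJ (nome (-u)) (nome τ) * h2

theorem thetaJ_nome_add_int_mul {τ : ℂ} (hτ : 0 < τ.im) (u : ℂ) (n : ℤ) :
    thetaJ (nome (u + n * τ)) (nome τ) =
      (-1) ^ n * nome (-(n * u) - n * (n - 1) / 2 * τ) * thetaJ (nome u) (nome τ) := by
  have step : ∀ n : ℤ, thetaJ (nome (u + (n + 1 : ℤ) * τ)) (nome τ) =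
      -nome (-(u + n * τ)) * thetaJ (nome (u + n * τ)) (nome τ) := fun n => by
    rw [← thetaJ_nome_add hτ]; congr 2; push_cast; ring
  have hc : ∀ n : ℤ, (-1) ^ (n + 1) *
      nome (-((n + 1 : ℤ) * u) - (n + 1 : ℤ) * ((n + 1 : ℤ) - 1) / 2 * τ) =
      -nome (-(u + n * τ)) * ((-1) ^ n * nome (-(n * u) - n * (n - 1) / 2 * τ)) := fun n => by
    rw [zpow_add_one₀ (by norm_num)]
    have : nome (-((n + 1 : ℤ) * u) - (n + 1 : ℤ) * ((n + 1 : ℤ) - 1) / 2 * τ) =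
      nome (-(u + n * τ)) * nome (-(n * u) - n * (n - 1) / 2 * τ) := by
      rw [← nome_add]; congr 1; push_cast; ring
    rw [this]; ring
  induction n using Int.induction_on with
  | zero => simp
  | succ n ih => rw [step, ih, hc, ← mul_assoc]
  | pred n ih =>
    have h1 := step (-n - 1)
    have h2 := hc (-n - 1)
    rw [sub_add_cancel] at h1 h2
    rw [h1, h2, mul_assoc] at ih
    exact mul_left_cancel₀ (neg_ne_zero.mpr (nome_ne_zero _)) ih

theorem thetaJ_ne_zero {q x : ℂ} (hq : ‖q‖ < 1) (hx₀ : x ≠ 0)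
    (hx : ∀ n : ℤ, x ≠ q ^ n) : thetaJ x q ≠ 0 := by
  refine mul_ne_zero (mul_ne_zero ?_ ?_) (qPoch_self_ne_zero hq)
  · refine qPoch_ne_zero hq fun i hi => hx (-i) ?_
    rw [zpow_neg, zpow_natCast]
    exact eq_inv_of_mul_eq_one_right hi
  · refine qPoch_ne_zero hq fun i hi => hx (i + 1) ?_
    rw [← mul_div_assoc, div_eq_one_iff_eq hx₀] at hi
    rw [← hi, ← pow_succ]
    norm_cast

theorem eventually_nome_ne_one : ∀ᶠ u in 𝓝[≠] (0 : ℂ), nome u ≠ 1 := by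
  have : ∀ᶠ u in 𝓝[≠] (0 : ℂ), ‖u‖ < 1 := by
    refine nhdsWithin_le_nhds ?_
    filter_upwards [Metric.ball_mem_nhds (0 : ℂ) one_pos] with u hu
    simpa using hu
  filter_upwards [this, self_mem_nhdsWithin] with u hu hu0 h
  obtain ⟨n, rfl⟩ := (nome_eq_one_iff u).mp h
  rw [Complex.norm_intCast, ← Int.cast_abs] at hu
  have : |n| < 1 := by exact_mod_cast hu
  have : n = 0 := by rwa [Int.abs_lt_one_iff] at this
  simp [this] at hu0

/-- The simple zero of the theta function at `x = 1`, with its leading coefficient. -/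
theorem tendsto_one_sub_div_thetaJ {τ : ℂ} (hτ : 0 < τ.im) :
    Tendsto (fun u => (1 - nome u) / thetaJ (nome u) (nome τ)) (𝓝[≠] 0)
      (𝓝 ((qPoch (nome τ) (nome τ) ^ 3)⁻¹)) := by
  have hq := norm_nome_lt_one hτ
  have hne := qPoch_self_ne_zero hq
  set q := nome τ
  have h1 : Continuous fun u => qPoch (q * nome u) q :=
    (continuous_qPoch hq).comp (continuous_const.mul continuous_nome)
  have h2 : Continuous fun u => qPoch (q / nome u) q :=
    (continuous_qPoch hq).comp (continuous_const.div continuous_nome nome_ne_zero)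
  have h3 : Tendsto (fun u => (qPoch (q * nome u) q * qPoch (q / nome u) q * qPoch q q)⁻¹) (𝓝[≠] 0)
      (𝓝 ((qPoch q q ^ 3)⁻¹)) := by
    have : Tendsto (fun u => qPoch (q * nome u) q * qPoch (q / nome u) q * qPoch q q) (𝓝[≠] 0)
        (𝓝 (qPoch q q ^ 3)) := by
      have h : Tendsto (fun u => qPoch (q * nome u) q * qPoch (q / nome u) q * qPoch q q) (𝓝[≠] 0)
          (𝓝 (qPoch (q * nome 0) q * qPoch (q / nome 0) q * qPoch q q)) :=
        (((h1.mul h2).mul continuous_const).tendsto 0).mono_left nhdsWithin_le_nhds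
      rw [nome_zero, mul_one, div_one] at h
      rwa [pow_three']
    exact this.inv₀ (pow_ne_zero _ hne)
  refine h3.congr' ?_
  filter_upwards [eventually_nome_ne_one] with u hu
  have h1u : 1 - nome u ≠ 0 := sub_ne_zero.mpr (Ne.symm hu)
  rw [thetaJ, qPoch_eq_one_sub_mul hq (nome u), mul_assoc, mul_assoc,
    mul_assoc (1 - nome u), div_mul_cancel_left₀ h1u]

theorem tendsto_one_sub_div_thetaJ_int_mul {τ : ℂ} (hτ : 0 < τ.im) (n : ℤ) :
    Tendsto (fun w => (1 - nome (w - n * τ)) / thetaJ (nome w) (nome τ)) (𝓝[≠] (n * τ))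
      (𝓝 ((-1) ^ n * nome (n * (n - 1) / 2 * τ) * (qPoch (nome τ) (nome τ) ^ 3)⁻¹)) := by
  have hsub : Tendsto (fun w : ℂ => w - n * τ) (𝓝[≠] (n * τ)) (𝓝[≠] 0) := by
    refine tendsto_nhdsWithin_iff.mpr ⟨?_, ?_⟩
    · have : Continuous fun w : ℂ => w - n * τ := by fun_prop
      simpa using (this.tendsto (n * τ)).mono_left nhdsWithin_le_nhds
    · filter_upwards [self_mem_nhdsWithin] with w hw
      exact sub_ne_zero.mpr hw
  have h1 := (tendsto_one_sub_div_thetaJ hτ).comp hsub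
  have h2 : Tendsto (fun w : ℂ => (-1) ^ n * nome (n * (w - n * τ) + n * (n - 1) / 2 * τ))
      (𝓝[≠] (n * τ)) (𝓝 ((-1) ^ n * nome (n * (n - 1) / 2 * τ))) := by
    have : Continuous fun w : ℂ => (-1) ^ n * nome (n * (w - n * τ) + n * (n - 1) / 2 * τ) :=
      continuous_const.mul (continuous_nome.comp (by fun_prop))
    simpa using (this.tendsto (n * τ)).mono_left nhdsWithin_le_nhds
  refine (h2.mul h1).congr fun w => ?_
  have h3 := thetaJ_nome_add_int_mul hτ (w - n * τ) n
  rw [sub_add_cancel] at h3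
  have h4 : nome (-(n * (w - n * τ)) - n * (n - 1) / 2 * τ) =
      (nome (n * (w - n * τ) + n * (n - 1) / 2 * τ))⁻¹ := by
    rw [← nome_neg]; congr 1; ring
  rw [h3, h4, Function.comp_apply]
  have h5 : ((-1 : ℂ) ^ n)⁻¹ = (-1) ^ n := by rw [← inv_zpow]; norm_num
  simp only [div_eq_mul_inv, mul_inv, inv_inv, h5]
  ring

/-! ### The theta functions of the Weyl--Kac formula -/

theorem bigTheta_eq (n : ℤ) {m : ℕ} (hm : m ≠ 0) (w τ : ℂ) :
    bigTheta n m w τ =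
      nome (n ^ 2 / (4 * m) * τ - n / 2 * w) * jacobiTheta₂ (n * τ - m * w) (2 * m * τ) := by
  have hm' : (m : ℂ) ≠ 0 := Nat.cast_ne_zero.mpr hm
  rw [bigTheta, jacobiTheta₂, ← tsum_mul_left]
  refine tsum_congr fun k => ?_
  rw [ePow_eq_nome, ePow_eq_nome, ← nome_add, jacobiTheta₂_term]
  unfold nome
  rw [← Complex.exp_add]
  congr 1
  field_simp
  ring

theorem two_mul_mul_im_pos {m : ℕ} (hm : m ≠ 0) {τ : ℂ} (hτ : 0 < τ.im) :
    0 < (2 * m * τ : ℂ).im := by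
  have : (2 * m * τ : ℂ).im = 2 * m * τ.im := by
    simp
  rw [this]
  have : (0 : ℝ) < m := by exact_mod_cast Nat.pos_of_ne_zero hm
  positivity

theorem differentiable_bigTheta (n : ℤ) {m : ℕ} (hm : m ≠ 0) {τ : ℂ} (hτ : 0 < τ.im) :
    Differentiable ℂ fun w => bigTheta n m w τ := by
  simp_rw [bigTheta_eq n hm]
  intro w
  refine DifferentiableAt.mul ?_ ?_
  · exact (differentiable_nome _).comp w (by fun_prop)
  · exact DifferentiableAt.comp (f := fun w => n * τ - m * w) w
      (differentiableAt_jacobiTheta₂_fst _ (two_mul_mul_im_pos hm hτ)) (by fun_prop)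

theorem bigTheta_neg_neg (n : ℤ) {m : ℕ} (hm : m ≠ 0) (w τ : ℂ) :
    bigTheta (-n) m (-w) τ = bigTheta n m w τ := by
  rw [bigTheta_eq _ hm, bigTheta_eq _ hm, ← jacobiTheta₂_neg_left]
  congr 2
  · push_cast; ring
  · push_cast; ring

theorem bigTheta_add_one (s : ℤ) {m : ℕ} (hm : m ≠ 0) (w τ : ℂ) :
    bigTheta (2 * s) m (w + 1) τ = bigTheta (2 * s) m w τ := by
  have hm' : (m : ℂ) ≠ 0 := Nat.cast_ne_zero.mpr hm
  refine tsum_congr fun k => ?_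
  rw [ePow_eq_nome (w + 1), ePow_eq_nome w]
  congr 1
  rw [← nome_add_int (_ * w) (-(m * k + s))]
  congr 1
  push_cast
  field_simp
  ring

theorem jacobiTheta₂_sub_left' (z τ : ℂ) :
    jacobiTheta₂ (z - τ) τ = nome (z - τ / 2) * jacobiTheta₂ z τ := by
  have h := jacobiTheta₂_add_left' (z - τ) τ
  rw [sub_add_cancel] at h
  rw [h, ← mul_assoc, nome, ← Complex.exp_add]
  ring_nf
  simp

theorem bigTheta_add_two_mul (n : ℤ) {m : ℕ} (hm : m ≠ 0) (w τ : ℂ) :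
    bigTheta n m (w + 2 * τ) τ = nome (-(m * τ) - m * w) * bigTheta n m w τ := by
  rw [bigTheta_eq _ hm, bigTheta_eq _ hm,
    show n * τ - m * (w + 2 * τ) = n * τ - m * w - 2 * m * τ by ring, jacobiTheta₂_sub_left',
    ← mul_assoc, ← mul_assoc, ← nome_add, ← nome_add]
  congr 2
  ring

theorem hasSum_even_add_odd {f : ℤ → ℂ} {a b : ℂ} (he : HasSum (fun k => f (2 * k)) a)
    (ho : HasSum (fun k => f (2 * k + 1)) b) : HasSum f (a + b) := by
  have h1 : Function.Injective fun k : ℤ => 2 * k := fun a b h => by simpa using h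
  have h2 : Function.Injective fun k : ℤ => 2 * k + 1 := fun a b h => by simpa using h
  refine (h1.hasSum_range_iff.mpr he).add_isCompl ?_ (h2.hasSum_range_iff.mpr ho)
  have hE : Set.range (fun k : ℤ => 2 * k) = {n | Even n} := by
    ext k; simp
  have hO : Set.range (fun k : ℤ => 2 * k + 1) = {n | Odd n} := by
    ext k; exact ⟨fun ⟨j, hj⟩ => ⟨j, hj.symm⟩, fun ⟨j, hj⟩ => ⟨j, hj.symm⟩⟩
  rw [hE, hO]
  exact Int.isCompl_even_odd

theorem bigTheta_one_two (w τ : ℂ) :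
    bigTheta 1 2 w τ = nome (τ / 8 - w / 2) *
      ∑' k : ℤ, jacobiTheta₂_term (2 * k) (w + 1 / 2 - τ / 2) τ := by
  rw [bigTheta, ← tsum_mul_left, ← (Equiv.neg ℤ).tsum_eq fun k : ℤ => _ * _]
  refine tsum_congr fun k => ?_
  rw [jacobiTheta₂_term_eq, ePow_eq_nome, ePow_eq_nome, ← nome_add, ← nome_int_mul,
    ← nome_int_mul, triangle_cast, Even.neg_one_zpow (even_two_mul k), one_mul, ← nome_add,
    ← nome_add]
  congr 1
  simp only [Equiv.neg_apply]
  push_cast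
  ring

theorem bigTheta_neg_one_two (w τ : ℂ) :
    bigTheta (-1) 2 w τ = -(nome (τ / 8 - w / 2) *
      ∑' k : ℤ, jacobiTheta₂_term (2 * k + 1) (w + 1 / 2 - τ / 2) τ) := by
  rw [bigTheta, ← tsum_mul_left, ← tsum_neg, ← (Equiv.neg ℤ).tsum_eq fun k : ℤ => _ * _]
  refine tsum_congr fun k => ?_
  rw [jacobiTheta₂_term_eq, ePow_eq_nome, ePow_eq_nome, ← nome_add, ← nome_int_mul,
    ← nome_int_mul, triangle_cast, Odd.neg_one_zpow ⟨k, rfl⟩,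
    show ∀ a b c : ℂ, -(a * (-1 * b * c)) = a * (b * c) by intros; ring, ← nome_add, ← nome_add]
  congr 1
  simp only [Equiv.neg_apply]
  push_cast
  ring

theorem jacobiTheta₂_eq_add {τ : ℂ} (hτ : 0 < τ.im) (z : ℂ) :
    jacobiTheta₂ z τ = (∑' k : ℤ, jacobiTheta₂_term (2 * k) z τ) +
      ∑' k : ℤ, jacobiTheta₂_term (2 * k + 1) z τ := by
  have hs := (hasSum_jacobiTheta₂_term z hτ).summable
  have h1 : Function.Injective fun k : ℤ => 2 * k := fun a b h => by simpa using h
  have h2 : Function.Injective fun k : ℤ => 2 * k + 1 := fun a b h => by simpa using h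
  exact (hasSum_even_add_odd (f := fun k => jacobiTheta₂_term k z τ)
    (hs.comp_injective h1).hasSum (hs.comp_injective h2).hasSum).tsum_eq

/-- The Weyl--Kac denominator in product form. -/
theorem bigTheta_one_two_sub {τ : ℂ} (hτ : 0 < τ.im) (w : ℂ) :
    bigTheta 1 2 w τ - bigTheta (-1) 2 w τ =
      nome (τ / 8 - w / 2) * thetaJ (nome w) (nome τ) := by
  have h := jacobiTheta₂_eq_add hτ (w + 1 / 2 - τ / 2)
  have h1 := bigTheta_one_two w τ
  have h2 := bigTheta_neg_one_two w τ
  have h3 := thetaJ_nome hτ w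
  rw [h3, h, mul_add, h1, h2, sub_neg_eq_add]

/-- The Weyl--Kac numerator `Θ_{2s,m} - Θ_{-2s,m}`. -/
noncomputable def weylNumerator (s : ℤ) (m : ℕ) (w τ : ℂ) : ℂ :=
  bigTheta (2 * s) m w τ - bigTheta (-(2 * s)) m w τ

theorem differentiable_weylNumerator (s : ℤ) {m : ℕ} (hm : m ≠ 0) {τ : ℂ} (hτ : 0 < τ.im) :
    Differentiable ℂ fun w => weylNumerator s m w τ :=
  (differentiable_bigTheta _ hm hτ).sub (differentiable_bigTheta _ hm hτ)

theorem weylNumerator_add_one (s : ℤ) {m : ℕ} (hm : m ≠ 0) (w τ : ℂ) :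
    weylNumerator s m (w + 1) τ = weylNumerator s m w τ := by
  rw [weylNumerator, ← mul_neg, bigTheta_add_one _ hm, bigTheta_add_one _ hm, weylNumerator,
    mul_neg]

theorem weylNumerator_add_two_mul (s : ℤ) {m : ℕ} (hm : m ≠ 0) (w τ : ℂ) :
    weylNumerator s m (w + 2 * τ) τ = nome (-(m * τ) - m * w) * weylNumerator s m w τ := by
  rw [weylNumerator, bigTheta_add_two_mul _ hm, bigTheta_add_two_mul _ hm, weylNumerator, mul_sub]

theorem weylNumerator_neg (s : ℤ) {m : ℕ} (hm : m ≠ 0) (w τ : ℂ) :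
    weylNumerator s m (-w) τ = -weylNumerator s m w τ := by
  have h1 := bigTheta_neg_neg (2 * s) hm w τ
  have h2 := bigTheta_neg_neg (-(2 * s)) hm w τ
  rw [neg_neg] at h2
  rw [weylNumerator, weylNumerator, h1, h2]
  ring

theorem weylNumerator_zero (s : ℤ) {m : ℕ} (hm : m ≠ 0) (τ : ℂ) :
    weylNumerator s m 0 τ = 0 := by
  have h := weylNumerator_neg s hm 0 τ
  rw [neg_zero] at h
  exact self_eq_neg.mp h

theorem weylNumerator_self (s : ℤ) {m : ℕ} (hm : m ≠ 0) (τ : ℂ) :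
    weylNumerator s m τ τ = 0 := by
  have h := weylNumerator_add_two_mul s hm (-τ) τ
  rw [weylNumerator_neg s hm, show -τ + 2 * τ = τ by ring,
    show -(m * τ) - m * -τ = 0 by ring, nome_zero, one_mul] at h
  exact self_eq_neg.mp h

/-- The value of a theta function at a point where it contributes to a pole of the character. -/
theorem bigTheta_eq_thetaJ (s : ℤ) {m : ℕ} (hm : m ≠ 0) {τ : ℂ} (hτ : 0 < τ.im) (w : ℂ) :
    bigTheta (2 * s) m w τ = nome (s ^ 2 / m * τ - s * w) *
      thetaJ (-nome (m * τ + 2 * s * τ - m * w)) (nome (2 * m * τ)) := by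
  have hm' : (m : ℂ) ≠ 0 := Nat.cast_ne_zero.mpr hm
  have hperiod := jacobiTheta₂_add_left (2 * s * τ - m * w) (2 * m * τ)
  rw [bigTheta_eq _ hm, ← nome_add_half, thetaJ_nome (two_mul_mul_im_pos hm hτ),
    show m * τ + 2 * s * τ - m * w + 1 / 2 + 1 / 2 - 2 * m * τ / 2 = 2 * s * τ - m * w + 1 by ring,
    hperiod]
  congr 2
  · push_cast; field_simp; ring
  · push_cast; ring

/-! ### Entire quasi-periodic functions -/

/-- The mean value of a periodic entire function over a horizontal period does not depend on the
height: it is a difference of values of a primitive, whose derivative vanishes by periodicity. -/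
theorem integral_add_eq_integral_add {h : ℂ → ℂ} (hd : Differentiable ℂ h)
    (hp : ∀ w, h (w + 1) = h w) (a b : ℂ) :
    ∫ x in (0 : ℝ)..1, h (x + a) = ∫ x in (0 : ℝ)..1, h (x + b) := by
  obtain ⟨H, hH⟩ := hd.isExactOn_univ
  have hint : ∀ a : ℂ, ∫ x in (0 : ℝ)..1, h (x + a) = H (a + 1) - H a := by
    intro a
    have hder : ∀ x ∈ Set.uIcc (0 : ℝ) 1,
        HasDerivAt (fun x : ℝ => H (x + a)) (h (x + a)) x := fun x _ => by
      have := (hH (x + a) trivial).comp_add_const (x : ℂ) a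
      exact this.comp_ofReal
    have hc : Continuous fun x : ℝ => h (x + a) := hd.continuous.comp (by fun_prop)
    rw [intervalIntegral.integral_eq_sub_of_hasDerivAt hder (hc.intervalIntegrable _ _)]
    simp [add_comm]
  have hder : ∀ a, HasDerivAt (fun a => H (a + 1) - H a) 0 a := fun a => by
    have h1 := (hH (a + 1) trivial).comp_add_const a 1
    have h2 := h1.sub (hH a trivial)
    rwa [hp, sub_self] at h2
  rw [hint, hint]
  exact is_const_of_deriv_eq_zero (fun a => (hder a).differentiableAt) (fun a => (hder a).deriv) a b

/-- A periodic function whose Fourier coefficients on a horizontal line vanish is zero there. -/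
theorem eq_zero_of_forall_integral_eq_zero {g : ℂ → ℂ} (hg : Continuous g)
    (hp : ∀ w, g (w + 1) = g w) (w : ℂ)
    (h0 : ∀ n : ℤ, ∫ x in (0 : ℝ)..1, g (x + w) * nome (-(n * (x + w))) = 0) : g w = 0 := by
  have hper : Function.Periodic (fun x : ℝ => g (x + w)) 1 := fun x => by
    change g _ = g _
    rw [← hp (x + w)]; congr 1; push_cast; ring
  have hcont : Continuous fun x : ℝ => g (x + w) := hg.comp (by fun_prop)
  have : Fact (0 < (1 : ℝ)) := ⟨one_pos⟩
  let f : C(AddCircle (1 : ℝ), ℂ) := ⟨hper.lift, continuous_coinduced_dom.mpr hcont⟩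
  have hcoef : fourierCoeff f = 0 := by
    ext n
    rw [fourierCoeff_eq_intervalIntegral _ n 0, zero_add]
    have : ∀ x : ℝ, fourier (-n) (x : AddCircle (1 : ℝ)) • f x =
        nome (n * w) * (g (x + w) * nome (-(n * (x + w)))) := fun x => by
      have hx : nome (-(n * (x + w))) = nome (-(n * x)) * (nome (n * w))⁻¹ := by
        rw [← nome_neg, ← nome_add]; congr 1; ring
      rw [fourier_coe_apply, hx, smul_eq_mul]
      change _ * g (x + w) = _
      field_simp [nome_ne_zero]
      rw [nome, mul_comm]
      congr 2
      push_cast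
      ring
    simp_rw [this]
    rw [intervalIntegral.integral_const_mul, h0]
    simp
  have hsum := has_pointwise_sum_fourier_series_of_summable (f := f)
    (by rw [hcoef]; exact summable_zero) ((0 : ℝ) : AddCircle (1 : ℝ))
  simp only [hcoef, Pi.zero_apply, zero_smul] at hsum
  have := hsum.unique hasSum_zero
  change g (((0 : ℝ) : ℂ) + w) = 0 at this
  simpa using this

/-- The quasi-periods `1` and `g (w + σ) = exp (-2πi w) g w` determine an entire function up to
a constant factor: they link all Fourier coefficients to the zeroth one. -/
theorem eq_zero_of_quasiperiodic {g : ℂ → ℂ} (hg : Differentiable ℂ g)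
    (hp : ∀ w, g (w + 1) = g w) {σ : ℂ} (hσ : ∀ w, g (w + σ) = nome (-w) * g w) (w₀ : ℂ)
    (h0 : ∫ x in (0 : ℝ)..1, g (x + w₀) = 0) (w : ℂ) : g w = 0 := by
  set a : ℤ → ℂ := fun n => ∫ x in (0 : ℝ)..1, g (x + w₀) * nome (-(n * (x + w₀))) with ha
  have hindep : ∀ (n : ℤ) (b : ℂ), ∫ x in (0 : ℝ)..1, g (x + b) * nome (-(n * (x + b))) = a n := by
    intro n b
    refine integral_add_eq_integral_add (h := fun w => g w * nome (-(n * w))) ?_ ?_ b w₀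
    · exact hg.mul (differentiable_nome.comp (by fun_prop))
    · intro w
      rw [hp, ← nome_add_int (-(n * w)) (-n)]
      congr 2; push_cast; ring
  have hrec : ∀ n, a n = nome (-(n * σ)) * a (n + 1) := by
    intro n
    rw [← hindep n (w₀ + σ), ha, ← intervalIntegral.integral_const_mul]
    congr 1
    ext x
    rw [← add_assoc, hσ]
    have : nome (-((n + 1 : ℤ) * (x + w₀))) = nome (-(x + w₀)) * nome (-(n * (x + w₀))) := by
      rw [← nome_add]; congr 1; push_cast; ring
    have h2 : nome (-(n * (x + w₀ + σ))) = nome (-(n * (x + w₀))) * nome (-(n * σ)) := by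
      rw [← nome_add]; congr 1; ring
    rw [this, h2]
    ring
  have hzero : ∀ n, a n = 0 := by
    intro n
    induction n using Int.induction_on with
    | zero => simpa [ha] using h0
    | succ n ih =>
      rw [hrec] at ih
      exact (mul_eq_zero.mp ih).resolve_left (nome_ne_zero _)
    | pred n ih => rw [hrec, sub_add_cancel, ih, mul_zero]
  exact eq_zero_of_forall_integral_eq_zero hg.continuous hp w fun n => by rw [hindep, hzero]

/-- A function with removable singularities in the set `S` agrees off `S` with an entire function.
The hypothesis `hS` says that `S` is closed and discrete. -/
theorem exists_differentiable_eq_of_removable {G : ℂ → ℂ} {S : Set ℂ}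
    (hG : ∀ w ∉ S, DifferentiableAt ℂ G w) (hS : ∀ w, ∀ᶠ v in 𝓝[≠] w, v ∉ S)
    (hlim : ∀ w ∈ S, Tendsto (fun v => (v - w) * G v) (𝓝[≠] w) (𝓝 0)) :
    ∃ g : ℂ → ℂ, Differentiable ℂ g ∧ ∀ w ∉ S, g w = G w := by
  have hoff : ∀ w ∉ S, limUnder (𝓝[≠] w) G = G w := fun w hw =>
    ((hG w hw).continuousAt.tendsto.mono_left nhdsWithin_le_nhds).limUnder_eq
  refine ⟨fun w => limUnder (𝓝[≠] w) G, fun w => ?_, hoff⟩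
  have hs : {v | v ≠ w → v ∉ S} ∈ 𝓝 w := eventually_nhdsWithin_iff.mp (hS w)
  by_cases hw : w ∈ S
  · have hd : DifferentiableOn ℂ G ({v | v ≠ w → v ∉ S} \ {w}) := fun v hv =>
      (hG v (hv.1 hv.2)).differentiableWithinAt
    have ho : (fun v => G v - G w) =o[𝓝[≠] w] fun v => (v - w)⁻¹ := by
      have hne : ∀ᶠ v in 𝓝[≠] w, v - w ≠ 0 := by
        filter_upwards [self_mem_nhdsWithin] with v hv using sub_ne_zero.mpr hv
      rw [Asymptotics.isLittleO_iff_tendsto' (by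
        filter_upwards [hne] with v hv h using absurd h (inv_ne_zero hv))]
      have hc : Tendsto (fun v => (v - w) * G w) (𝓝[≠] w) (𝓝 0) := by
        have : Continuous fun v => (v - w) * G w := by fun_prop
        simpa using (this.tendsto w).mono_left nhdsWithin_le_nhds
      refine (by simpa using (hlim w hw).sub hc : Tendsto _ _ (𝓝 (0 : ℂ))).congr fun v => ?_
      rw [div_inv_eq_mul]; ring
    have h := (differentiableOn_update_limUnder_of_isLittleO hs hd ho).differentiableAt hs
    refine h.congr_of_eventuallyEq ?_
    filter_upwards [hs] with v hv
    by_cases hvw : v = w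
    · rw [hvw, Function.update_self]
    · rw [Function.update_of_ne hvw, hoff v (hv hvw)]
  · refine (hG w hw).congr_of_eventuallyEq ?_
    filter_upwards [hs] with v hv
    by_cases hvw : v = w
    · rw [hvw, hoff w hw]
    · rw [hoff v (hv hvw)]

/-! ### The numerator of the Appell function -/

/-- The `k`-th term of `appellSum s y Q`. -/
noncomputable def appellTerm (s y Q : ℂ) (k : ℤ) : ℂ :=
  Q ^ (k * (k - 1) / 2) * y ^ k / (1 - Q ^ (k - 1) * s * y)

/-- The numerator of the Appell function `m(-s, -y; Q)`, in which all signs cancel. -/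
noncomputable def appellSum (s y Q : ℂ) : ℂ := ∑' k : ℤ, appellTerm s y Q k

theorem appellM_neg_neg (s y Q : ℂ) :
    appellM (-s) (-y) Q = appellSum s y Q / thetaJ (-y) Q := by
  rw [appellM, appellSum, one_div, div_eq_inv_mul]
  congr 1
  refine tsum_congr fun k => ?_
  have h : (-1 : ℂ) ^ k * (-1) ^ k = 1 := by rw [← mul_zpow]; norm_num
  rw [appellTerm, neg_eq_neg_one_mul y, mul_zpow]
  congr 1
  · linear_combination Q ^ (k * (k - 1) / 2) * y ^ k * h
  · ring

/-- The shift of the summation index by one turns `y` into `Q y`. -/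
theorem appellSum_mul {Q y : ℂ} (hQ : Q ≠ 0) (hy : y ≠ 0) (s : ℂ) :
    appellSum s (Q * y) Q = y⁻¹ * appellSum s y Q := by
  rw [appellSum, appellSum, ← tsum_mul_left, ← (Equiv.addRight (1 : ℤ)).tsum_eq (fun k => y⁻¹ * _)]
  refine tsum_congr fun k => ?_
  rw [Equiv.coe_addRight, appellTerm, appellTerm, triangle_succ, zpow_add₀ hQ, zpow_add_one₀ hy,
    mul_zpow, add_sub_cancel_right, zpow_sub_one₀ hQ]
  field_simp

/-- On an annulus, the denominators of all but finitely many terms of the Appell sum are bounded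
away from zero. -/
theorem exists_half_le_norm_one_sub {Q s : ℂ} (hQ₀ : Q ≠ 0) (hQ : ‖Q‖ < 1) (hs : s ≠ 0) {r R : ℝ}
    (hr : 0 < r) (hrR : r ≤ R) :
    ∃ n : ℕ, ∀ k ∉ Finset.Icc (-n : ℤ) (n + 1), ∀ y : ℂ, r ≤ ‖y‖ → ‖y‖ ≤ R →
      1 / 2 ≤ ‖1 - Q ^ (k - 1) * s * y‖ := by
  have hs' : 0 < ‖s‖ := norm_pos_iff.mpr hs
  have hQ' : 0 < ‖Q‖ := norm_pos_iff.mpr hQ₀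
  have hR : 0 < R := hr.trans_le hrR
  obtain ⟨n, hn⟩ := exists_pow_lt_of_lt_one
    (show 0 < min ((2 * (‖s‖ * R))⁻¹) (‖s‖ * r * 2 / 3) by positivity) hQ
  rw [lt_min_iff] at hn
  refine ⟨n, fun k hk y hry hyR => ?_⟩
  rw [Finset.mem_Icc, not_and_or, not_le, not_le] at hk
  rcases hk with hk | hk
  · have h1 : ‖Q‖ ^ (-n : ℤ) ≤ ‖Q‖ ^ (k - 1) :=
      zpow_le_zpow_right_of_le_one₀ hQ' hQ.le (by omega)
    rw [zpow_neg, zpow_natCast] at h1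
    have h2 : 3 / 2 ≤ ‖Q‖ ^ (k - 1) * (‖s‖ * ‖y‖) := by
      calc (3 / 2 : ℝ) ≤ (‖Q‖ ^ n)⁻¹ * (‖s‖ * r) := by
            rw [inv_mul_eq_div, le_div_iff₀ (by positivity)]; linarith
        _ ≤ _ := by gcongr
    have h3 := norm_sub_norm_le (Q ^ (k - 1) * s * y) 1
    rw [norm_sub_rev, norm_mul, norm_mul, norm_zpow, norm_one, mul_assoc] at h3
    linarith
  · have h1 : ‖Q‖ ^ (k - 1) ≤ ‖Q‖ ^ (n : ℤ) :=
      zpow_le_zpow_right_of_le_one₀ hQ' hQ.le (by omega)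
    rw [zpow_natCast] at h1
    have h2 : ‖Q‖ ^ (k - 1) * (‖s‖ * ‖y‖) ≤ 1 / 2 := by
      calc ‖Q‖ ^ (k - 1) * (‖s‖ * ‖y‖) ≤ ‖Q‖ ^ n * (‖s‖ * R) := by gcongr
        _ ≤ (2 * (‖s‖ * R))⁻¹ * (‖s‖ * R) := by gcongr; exact hn.1.le
        _ = 1 / 2 := by field_simp
    have h3 := norm_sub_norm_le 1 (Q ^ (k - 1) * s * y)
    rw [norm_mul, norm_mul, norm_zpow, norm_one, mul_assoc] at h3
    linarith

theorem zpow_le_add_zpow {r R t : ℝ} (hr : 0 < r) (h1 : r ≤ t) (h2 : t ≤ R) (k : ℤ) :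
    t ^ k ≤ r ^ k + R ^ k := by
  have ht : 0 < t := hr.trans_le h1
  have hR : 0 < R := ht.trans_le h2
  have h3 : 0 < r ^ k := zpow_pos hr k
  have h4 : 0 < R ^ k := zpow_pos hR k
  rcases le_total 0 k with hk | hk
  · have := zpow_le_zpow_left₀ hk ht.le h2
    linarith
  · obtain ⟨m, rfl⟩ : ∃ m : ℤ, k = -m := ⟨-k, by ring⟩
    have := zpow_le_zpow_left₀ (show 0 ≤ m by omega) hr.le h1
    have h5 : t ^ (-m) ≤ r ^ (-m) := by
      rw [zpow_neg, zpow_neg]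
      exact inv_anti₀ (zpow_pos hr m) this
    linarith

theorem differentiableAt_appellTerm {s y Q : ℂ} (hy : y ≠ 0) {k : ℤ}
    (h : Q ^ (k - 1) * s * y ≠ 1) : DifferentiableAt ℂ (fun y => appellTerm s y Q k) y := by
  unfold appellTerm
  refine DifferentiableAt.div ?_ (by fun_prop) (sub_ne_zero.mpr h.symm)
  exact (differentiableAt_zpow.mpr (Or.inl hy)).const_mul _

/-- Near a nonzero point, all but finitely many terms of the Appell sum are free of poles, and
these sum up to a holomorphic function. -/
theorem exists_appellSum_eq_sum_add {Q s y₀ : ℂ} (hQ₀ : Q ≠ 0) (hQ : ‖Q‖ < 1) (hs : s ≠ 0)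
    (hy₀ : y₀ ≠ 0) : ∃ (F : Finset ℤ) (f : ℂ → ℂ), 0 ∈ F ∧ DifferentiableAt ℂ f y₀ ∧
      ∀ᶠ y in 𝓝 y₀, appellSum s y Q = ∑ k ∈ F, appellTerm s y Q k + f y := by
  have hy : 0 < ‖y₀‖ := norm_pos_iff.mpr hy₀
  set r := ‖y₀‖ / 2 with hr
  set R := 2 * ‖y₀‖ with hR
  have hr0 : 0 < r := by positivity
  have hR0 : 0 < R := by positivity
  obtain ⟨n, hn⟩ := exists_half_le_norm_one_sub hQ₀ hQ hs hr0 (show r ≤ R by linarith)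
  set F := Finset.Icc (-n : ℤ) (n + 1) with hF
  set U : Set ℂ := {y | r < ‖y‖} ∩ {y | ‖y‖ < R} with hU
  have hUo : IsOpen U :=
    (isOpen_lt continuous_const continuous_norm).inter (isOpen_lt continuous_norm continuous_const)
  have hU₀ : y₀ ∈ U := ⟨show r < ‖y₀‖ by linarith, show ‖y₀‖ < R by linarith⟩
  set u : ℤ → ℝ := fun k => 2 * (‖Q ^ (k * (k - 1) / 2) * (r : ℂ) ^ k‖ +
    ‖Q ^ (k * (k - 1) / 2) * (R : ℂ) ^ k‖) with hu
  have hsu : Summable u := ((summable_norm_theta_term hQ₀ hQ (by exact_mod_cast hr0.ne')).add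
    (summable_norm_theta_term hQ₀ hQ (by exact_mod_cast hR0.ne'))).mul_left 2
  have hbound : ∀ k : ℤ, ∀ y ∈ U, ‖if k ∈ F then 0 else appellTerm s y Q k‖ ≤ u k := by
    intro k y hy
    split_ifs with hk
    · rw [norm_zero]; positivity
    · have h1 := hn k hk y hy.1.le hy.2.le
      have h2 := zpow_le_add_zpow hr0 hy.1.le hy.2.le k
      rw [appellTerm, norm_div, div_le_iff₀ (by linarith), hu]
      simp only [norm_mul, norm_zpow, Complex.norm_real, Real.norm_of_nonneg hr0.le,
        Real.norm_of_nonneg hR0.le]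
      calc ‖Q‖ ^ (k * (k - 1) / 2) * ‖y‖ ^ k
          ≤ ‖Q‖ ^ (k * (k - 1) / 2) * (r ^ k + R ^ k) := by gcongr
        _ = 2 * (‖Q‖ ^ (k * (k - 1) / 2) * r ^ k + ‖Q‖ ^ (k * (k - 1) / 2) * R ^ k) * (1 / 2) := by
          ring
        _ ≤ _ := by gcongr
  have hdiff : ∀ k : ℤ,
      DifferentiableOn ℂ (fun y => if k ∈ F then 0 else appellTerm s y Q k) U := by
    intro k y hy
    split_ifs with hk
    · exact differentiableWithinAt_const _
    · refine (differentiableAt_appellTerm ?_ fun h => ?_).differentiableWithinAt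
      · exact norm_pos_iff.mp (hr0.trans hy.1)
      · have := hn k hk y hy.1.le hy.2.le
        rw [h, sub_self, norm_zero] at this
        linarith
  refine ⟨F, fun y => ∑' k : ℤ, if k ∈ F then 0 else appellTerm s y Q k, ?_, ?_, ?_⟩
  · rw [hF, Finset.mem_Icc]; omega
  · exact (differentiableOn_tsum_of_summable_norm hsu hdiff hUo hbound).differentiableAt
      (hUo.mem_nhds hU₀)
  · filter_upwards [hUo.mem_nhds hU₀] with y hy
    have h1 : Summable fun k : ℤ => if k ∈ F then 0 else appellTerm s y Q k :=
      hsu.of_norm_bounded fun k => hbound k y hy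
    have h2 : HasSum (fun k : ℤ => if k ∈ F then appellTerm s y Q k else 0)
        (∑ k ∈ F, appellTerm s y Q k) := by
      rw [Finset.sum_congr rfl fun k hk => (if_pos hk).symm]
      exact hasSum_sum_of_ne_finset_zero fun k hk => if_neg hk
    rw [appellSum, ← (h2.add h1.hasSum).tsum_eq]
    refine tsum_congr fun k => ?_
    split_ifs <;> simp

theorem differentiableAt_appellSum {Q s y₀ : ℂ} (hQ₀ : Q ≠ 0) (hQ : ‖Q‖ < 1) (hs : s ≠ 0)
    (hy₀ : y₀ ≠ 0) (h : ∀ k : ℤ, Q ^ k * s * y₀ ≠ 1) :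
    DifferentiableAt ℂ (fun y => appellSum s y Q) y₀ := by
  obtain ⟨F, f, -, hf, hev⟩ := exists_appellSum_eq_sum_add hQ₀ hQ hs hy₀
  refine DifferentiableAt.congr_of_eventuallyEq ?_ hev
  refine DifferentiableAt.add ?_ hf
  exact DifferentiableAt.fun_sum fun k _ => differentiableAt_appellTerm hy₀ (h _)

/-- At `y = Q / s` the Appell sum has a simple pole, which comes from its term of index `0`. -/
theorem tendsto_mul_appellSum {Q s y₀ : ℂ} (hQ₀ : Q ≠ 0) (hQ : ‖Q‖ < 1) (hs : s ≠ 0)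
    (hy₀ : s * y₀ = Q) :
    Tendsto (fun y => (1 - Q⁻¹ * s * y) * appellSum s y Q) (𝓝[≠] y₀) (𝓝 1) := by
  have hy : y₀ ≠ 0 := by rintro rfl; simp at hy₀; exact hQ₀ hy₀.symm
  obtain ⟨F, f, h0F, hf, hev⟩ := exists_appellSum_eq_sum_add hQ₀ hQ hs hy
  have hpole : Q⁻¹ * s * y₀ = 1 := by rw [mul_assoc, hy₀, inv_mul_cancel₀ hQ₀]
  have hg : ContinuousAt (fun y => ∑ k ∈ F.erase 0, appellTerm s y Q k + f y) y₀ := by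
    refine ContinuousAt.add ?_ hf.continuousAt
    refine (DifferentiableAt.fun_sum fun k hk => differentiableAt_appellTerm hy ?_).continuousAt
    intro h
    have h1 : Q ^ (k - 1) * s * y₀ = Q ^ k * (Q⁻¹ * s * y₀) := by rw [zpow_sub_one₀ hQ₀]; ring
    rw [h1, hpole, mul_one] at h
    have h2 : ‖Q‖ ^ k = 1 := by rw [← norm_zpow, h, norm_one]
    exact Finset.ne_of_mem_erase hk
      ((zpow_eq_one_iff_right₀ (norm_nonneg _) hQ.ne).mp h2)
  have hc : ContinuousAt (fun y => 1 - Q⁻¹ * s * y) y₀ := by fun_prop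
  have h1 : Tendsto (fun y => 1 + (1 - Q⁻¹ * s * y) * (∑ k ∈ F.erase 0, appellTerm s y Q k + f y))
      (𝓝[≠] y₀) (𝓝 1) := by
    have : ContinuousAt (fun y => 1 + (1 - Q⁻¹ * s * y) *
        (∑ k ∈ F.erase 0, appellTerm s y Q k + f y)) y₀ := continuousAt_const.add (hc.mul hg)
    have := this.tendsto.mono_left (nhdsWithin_le_nhds (s := {y₀}ᶜ))
    simpa only [hpole, sub_self, zero_mul, add_zero] using this
  refine h1.congr' ?_
  filter_upwards [nhdsWithin_le_nhds hev, self_mem_nhdsWithin] with y hy hne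
  have hne' : 1 - Q⁻¹ * s * y ≠ 0 := by
    intro h
    apply hne
    have h3 : Q⁻¹ * s * y = Q⁻¹ * s * y₀ := by rw [hpole]; linear_combination -h
    exact mul_left_cancel₀ (mul_ne_zero (inv_ne_zero hQ₀) hs) h3
  rw [hy, ← Finset.add_sum_erase _ _ h0F, appellTerm]
  simp only [zero_mul, Int.zero_ediv, zpow_zero, mul_one, zero_sub, zpow_neg_one]
  rw [add_assoc, mul_add _ (1 / _), mul_one_div_cancel hne']

/-! ### Mean values on circles -/

theorem integral_tsum_eq_zero {ι : Type*} [Countable ι] {f : ι → ℝ → ℂ} {b : ι → ℝ}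
    (hf : ∀ i, Continuous (f i)) (hb : Summable b) (hfb : ∀ i x, ‖f i x‖ ≤ b i)
    (h0 : ∀ i, ∫ x in (0 : ℝ)..1, f i x = 0) : ∫ x in (0 : ℝ)..1, ∑' i, f i x = 0 := by
  have key := intervalIntegral.hasSum_integral_of_dominated_convergence
    (μ := MeasureTheory.volume) (a := 0) (b := 1) (F := f) (f := fun x => ∑' i, f i x)
    (fun i _ => b i) (fun i => (hf i).aestronglyMeasurable)
    (fun i => Eventually.of_forall fun x _ => hfb i x)
    (Eventually.of_forall fun x _ => hb) (by simp)
    (Eventually.of_forall fun x _ => (hb.of_norm_bounded fun i => hfb i x).hasSum)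
  simp_rw [h0] at key
  exact key.unique hasSum_zero

theorem integral_nome_int_mul {n : ℤ} (hn : n ≠ 0) : ∫ x in (0 : ℝ)..1, nome (n * x) = 0 := by
  have := integral_ePow_int 0 n
  simpa [ePow_eq_nome, hn] using this

theorem integral_zpow_circle {ε n : ℤ} (hε : ε ≠ 0) (hn : n ≠ 0) (y₀ : ℂ) :
    ∫ x in (0 : ℝ)..1, (y₀ * nome (ε * x)) ^ n = 0 := by
  have : ∀ x : ℝ, (y₀ * nome (ε * x)) ^ n = y₀ ^ n * nome ((n * ε : ℤ) * x) := fun x => by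
    rw [mul_zpow, ← nome_int_mul]; congr 2; push_cast; ring
  simp_rw [this]
  rw [intervalIntegral.integral_const_mul, integral_nome_int_mul (mul_ne_zero hn hε), mul_zero]

theorem norm_mul_nome (ε : ℤ) (y₀ : ℂ) (x : ℝ) : ‖y₀ * nome (ε * x)‖ = ‖y₀‖ := by
  rw [norm_mul, norm_nome]; simp

theorem continuous_circle (ε : ℤ) (y₀ : ℂ) : Continuous fun x : ℝ => y₀ * nome (ε * x) :=
  continuous_const.mul (continuous_nome.comp (by fun_prop))

/-- The geometric expansion of the integrand, in powers of `a y` or of its inverse, has no constant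
term. -/
theorem integral_zpow_div_one_sub {ε k : ℤ} (hε : ε ≠ 0) {a y₀ : ℂ} (ha : a ≠ 0) (hy₀ : y₀ ≠ 0)
    (h : (0 < k ∧ ‖a * y₀‖ < 1) ∨ (k ≤ 0 ∧ 1 < ‖a * y₀‖)) :
    ∫ x in (0 : ℝ)..1, (y₀ * nome (ε * x)) ^ k / (1 - a * (y₀ * nome (ε * x))) = 0 := by
  have hne : ∀ x : ℝ, y₀ * nome (ε * x) ≠ 0 := fun x => mul_ne_zero hy₀ (nome_ne_zero _)
  have hcont : ∀ n : ℤ, Continuous fun x : ℝ => (y₀ * nome (ε * x)) ^ n := fun n =>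
    (continuous_circle ε y₀).zpow₀ n fun x => Or.inl (hne x)
  rcases h with ⟨hk, h⟩ | ⟨hk, h⟩
  · have hexp : ∀ x : ℝ, (y₀ * nome (ε * x)) ^ k / (1 - a * (y₀ * nome (ε * x))) =
        ∑' i : ℕ, a ^ i * (y₀ * nome (ε * x)) ^ (k + i) := fun x => by
      have h' : ‖a * (y₀ * nome (ε * x))‖ < 1 := by rwa [norm_mul, norm_mul_nome, ← norm_mul]
      rw [div_eq_mul_inv, ← tsum_geometric_of_norm_lt_one h', ← tsum_mul_left]
      refine tsum_congr fun i => ?_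
      rw [zpow_add₀ (hne x), zpow_natCast, mul_pow]; ring
    simp_rw [hexp]
    refine integral_tsum_eq_zero (b := fun i : ℕ => ‖y₀‖ ^ k * ‖a * y₀‖ ^ i)
      (fun i => continuous_const.mul (hcont _))
      ((summable_geometric_of_lt_one (norm_nonneg _) h).mul_left _) (fun i x => ?_) (fun i => ?_)
    · rw [norm_mul, norm_zpow, norm_mul_nome, norm_pow, zpow_add₀ (norm_ne_zero_iff.mpr hy₀),
        zpow_natCast, norm_mul, mul_pow]
      exact le_of_eq (by ring)
    · rw [intervalIntegral.integral_const_mul, integral_zpow_circle hε (by omega), mul_zero]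
  · have h1 : ‖(a * y₀)⁻¹‖ < 1 := by rw [norm_inv]; exact inv_lt_one_of_one_lt₀ h
    have hexp : ∀ x : ℝ, (y₀ * nome (ε * x)) ^ k / (1 - a * (y₀ * nome (ε * x))) =
        ∑' i : ℕ, -(a⁻¹ ^ (i + 1)) * (y₀ * nome (ε * x)) ^ (k - 1 - i) := fun x => by
      have h' : ‖(a * (y₀ * nome (ε * x)))⁻¹‖ < 1 := by
        rwa [norm_inv, norm_mul, norm_mul_nome, ← norm_mul, ← norm_inv]
      set y := y₀ * nome (ε * x) with hy
      have hyx : y ≠ 0 := hne x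
      have h2 : a * y ≠ 1 := fun h => by rw [h] at h'; simp at h'
      have h3 : y ^ k / (1 - a * y) = -(a⁻¹ * y ^ (k - 1)) * (1 - (a * y)⁻¹)⁻¹ := by
        have h4 : 1 - a * y ≠ 0 := sub_ne_zero.mpr h2.symm
        have h5 : a * y - 1 ≠ 0 := sub_ne_zero.mpr h2
        have h6 : 1 - (a * y)⁻¹ = (a * y - 1) / (a * y) := by field_simp
        rw [h6, inv_div, zpow_sub_one₀ hyx]
        field_simp
        ring
      rw [h3, ← tsum_geometric_of_norm_lt_one h', ← tsum_mul_left]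
      refine tsum_congr fun i => ?_
      rw [zpow_sub₀ hyx (k - 1), zpow_natCast, mul_inv, mul_pow, inv_pow y]; ring
    simp_rw [hexp]
    refine integral_tsum_eq_zero
      (b := fun i : ℕ => ‖a⁻¹‖ * ‖y₀‖ ^ (k - 1) * ‖(a * y₀)⁻¹‖ ^ i)
      (fun i => continuous_const.mul (hcont _))
      ((summable_geometric_of_lt_one (norm_nonneg _) h1).mul_left _) (fun i x => ?_) (fun i => ?_)
    · rw [norm_mul, norm_zpow, norm_mul_nome, norm_neg, norm_pow,
        zpow_sub₀ (norm_ne_zero_iff.mpr hy₀) (k - 1), zpow_natCast, mul_inv, norm_mul, mul_pow,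
        norm_inv y₀, inv_pow ‖y₀‖]
      exact le_of_eq (by ring)
    · rw [intervalIntegral.integral_const_mul, integral_zpow_circle hε (by omega), mul_zero]

/-- On a circle inside the annulus `‖Q‖ < ‖s y‖ < 1` the expansion of the Appell sum has no
constant term: the terms of positive index have only positive powers of `y`, the others only
negative ones. -/
theorem integral_appellSum_eq_zero {ε : ℤ} (hε : ε ≠ 0) {Q s y₀ : ℂ} (hQ₀ : Q ≠ 0) (hQ : ‖Q‖ < 1)
    (h1 : ‖s * y₀‖ < 1) (h2 : ‖Q‖ < ‖s * y₀‖) :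
    ∫ x in (0 : ℝ)..1, appellSum s (y₀ * nome (ε * x)) Q = 0 := by
  have hQ' : 0 < ‖Q‖ := norm_pos_iff.mpr hQ₀
  have hsy : s * y₀ ≠ 0 := norm_pos_iff.mp (hQ'.trans h2)
  have hs : s ≠ 0 := left_ne_zero_of_mul hsy
  have hy₀ : y₀ ≠ 0 := right_ne_zero_of_mul hsy
  have hpos : ∀ k : ℤ, 0 < k → ‖Q ^ (k - 1) * s * y₀‖ ≤ ‖s * y₀‖ := fun k hk => by
    rw [mul_assoc, norm_mul, norm_zpow]
    refine mul_le_of_le_one_left (norm_nonneg _) ?_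
    have := zpow_le_zpow_right_of_le_one₀ hQ' hQ.le (show 0 ≤ k - 1 by omega)
    simpa using this
  have hneg : ∀ k : ℤ, k ≤ 0 → ‖Q‖⁻¹ * ‖s * y₀‖ ≤ ‖Q ^ (k - 1) * s * y₀‖ := fun k hk => by
    rw [mul_assoc, norm_mul (Q ^ _), norm_zpow]
    have := zpow_le_zpow_right_of_le_one₀ hQ' hQ.le (show k - 1 ≤ -1 by omega)
    rw [zpow_neg_one] at this
    gcongr
  have h2' : 1 < ‖Q‖⁻¹ * ‖s * y₀‖ := by rwa [inv_mul_eq_div, one_lt_div hQ']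
  set δ := min (1 - ‖s * y₀‖) (‖Q‖⁻¹ * ‖s * y₀‖ - 1) with hδ
  have hδ0 : 0 < δ := lt_min (by linarith) (by linarith)
  have hden : ∀ (k : ℤ) (x : ℝ), δ ≤ ‖1 - Q ^ (k - 1) * s * (y₀ * nome (ε * x))‖ := by
    intro k x
    have hn : ‖Q ^ (k - 1) * s * (y₀ * nome (ε * x))‖ = ‖Q ^ (k - 1) * s * y₀‖ := by
      rw [norm_mul, norm_mul_nome, ← norm_mul]
    rcases lt_or_ge 0 k with hk | hk
    · have := norm_sub_norm_le 1 (Q ^ (k - 1) * s * (y₀ * nome (ε * x)))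
      rw [hn, norm_one] at this
      have := hpos k hk
      have : δ ≤ 1 - ‖s * y₀‖ := min_le_left _ _
      linarith
    · have := norm_sub_norm_le (Q ^ (k - 1) * s * (y₀ * nome (ε * x))) 1
      rw [hn, norm_one, norm_sub_rev] at this
      have := hneg k hk
      have : δ ≤ ‖Q‖⁻¹ * ‖s * y₀‖ - 1 := min_le_right _ _
      linarith
  unfold appellSum appellTerm
  refine integral_tsum_eq_zero
    (b := fun k : ℤ => ‖Q ^ (k * (k - 1) / 2) * y₀ ^ k‖ * δ⁻¹) (fun k => ?_)
    ((summable_norm_theta_term hQ₀ hQ hy₀).mul_right _) (fun k x => ?_) (fun k => ?_)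
  · refine Continuous.div ?_ ?_ fun x h => ?_
    · exact continuous_const.mul ((continuous_circle ε y₀).zpow₀ k
        fun x => Or.inl (mul_ne_zero hy₀ (nome_ne_zero _)))
    · exact continuous_const.sub (continuous_const.mul (continuous_circle ε y₀))
    · have := hden k x
      rw [h, norm_zero] at this
      linarith
  · rw [norm_div, norm_mul, norm_mul, norm_zpow (y₀ * _), norm_mul_nome, norm_zpow y₀,
      ← div_eq_mul_inv]
    gcongr
    exact hden k x
  · simp_rw [mul_div_assoc]
    rw [intervalIntegral.integral_const_mul, integral_zpow_div_one_sub hε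
      (mul_ne_zero (zpow_ne_zero _ hQ₀) hs) hy₀, mul_zero]
    rcases lt_or_ge 0 k with hk | hk
    · exact Or.inl ⟨hk, (hpos k hk).trans_lt h1⟩
    · exact Or.inr ⟨hk, h2'.trans_le (hneg k hk)⟩

/-- Only the constant term of the theta series contributes to its mean value. -/
theorem integral_jacobiTheta₂ (z : ℂ) {τ : ℂ} (hτ : 0 < τ.im) :
    ∫ x in (0 : ℝ)..1, jacobiTheta₂ (x + z) τ = 1 := by
  have hterm : ∀ (n : ℤ) (x : ℝ),
      jacobiTheta₂_term n (x + z) τ = jacobiTheta₂_term n z τ * nome (n * x) := fun n x => by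
    rw [jacobiTheta₂_term, jacobiTheta₂_term, nome, ← Complex.exp_add]; congr 1; ring
  have hnorm : ∀ (n : ℤ) (x : ℝ),
      ‖jacobiTheta₂_term n (x + z) τ‖ = ‖jacobiTheta₂_term n z τ‖ := fun n x => by
    rw [hterm, norm_mul_nome]
  have hs := ((summable_jacobiTheta₂_term_iff z τ).mpr hτ).norm
  have key := intervalIntegral.hasSum_integral_of_dominated_convergence
    (μ := MeasureTheory.volume) (a := 0) (b := 1)
    (F := fun (n : ℤ) (x : ℝ) => jacobiTheta₂_term n (x + z) τ)
    (f := fun x : ℝ => jacobiTheta₂ (x + z) τ)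
    (fun n _ => ‖jacobiTheta₂_term n z τ‖)
    (fun n => by
      simp_rw [hterm]
      exact (continuous_circle n (jacobiTheta₂_term n z τ)).aestronglyMeasurable)
    (fun n => Eventually.of_forall fun x _ => (hnorm n x).le)
    (Eventually.of_forall fun x _ => hs) (by simp)
    (Eventually.of_forall fun x _ => hasSum_jacobiTheta₂_term (x + z) hτ)
  have hint : (fun n : ℤ => ∫ x in (0 : ℝ)..1, jacobiTheta₂_term n (x + z) τ) =
      fun n => if n = 0 then 1 else 0 := by
    funext n
    simp_rw [hterm]
    split_ifs with hn
    · simp [hn, jacobiTheta₂_term]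
    · rw [intervalIntegral.integral_const_mul, integral_nome_int_mul hn, mul_zero]
  rw [hint] at key
  exact key.unique (hasSum_ite_eq 0 1)

/-! ### The polar part of the character -/

theorem two_mul_natCast_mul_im_pos {p : ℕ} (hp : 1 ≤ p) {τ : ℂ} (hτ : 0 < τ.im) :
    0 < (2 * p * τ : ℂ).im := two_mul_mul_im_pos (by omega) hτ

theorem natCast_mul_im_pos {p : ℕ} (hp : 1 ≤ p) {τ : ℂ} (hτ : 0 < τ.im) :
    0 < (p * τ : ℂ).im := by
  have : (p * τ : ℂ).im = p * τ.im := by simp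
  rw [this]
  have : (0 : ℝ) < p := by exact_mod_cast hp
  positivity

theorem norm_nome_mul_lt {τ : ℂ} (hτ : 0 < τ.im) {a b : ℝ} (h : a < b) :
    ‖nome (b * τ)‖ < ‖nome (a * τ)‖ := by
  rw [norm_nome, norm_nome, Complex.im_ofReal_mul, Complex.im_ofReal_mul, Real.exp_lt_exp]
  have := Real.pi_pos
  have : 0 < 2 * Real.pi * τ.im := by positivity
  nlinarith

theorem nome_int_mul_ne_one {τ : ℂ} (hτ : 0 < τ.im) {n : ℤ} (hn : n ≠ 0) : nome (n * τ) ≠ 1 := by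
  intro h
  apply hn
  have h2 : ‖nome τ‖ ^ n = 1 := by rw [← norm_zpow, ← nome_int_mul, h, norm_one]
  exact (zpow_eq_one_iff_right₀ (norm_nonneg _) (norm_nome_lt_one hτ).ne).mp h2

/-- The points `w` with `exp (2πi w) ∈ q^ℤ`, where the Weyl--Kac denominator vanishes. -/
def latticePoints (τ : ℂ) : Set ℂ := {w | ∃ n : ℤ, nome w = nome τ ^ n}

theorem mem_latticePoints_iff {τ w : ℂ} :
    w ∈ latticePoints τ ↔ ∃ n k : ℤ, w = n * τ + k := by
  refine exists_congr fun n => ?_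
  rw [← nome_int_mul, nome_eq_nome_iff]

theorem add_half_notMem_latticePoints {τ : ℂ} (hτ : 0 < τ.im) (x : ℝ) :
    (x + τ / 2 : ℂ) ∉ latticePoints τ := by
  rw [mem_latticePoints_iff]
  rintro ⟨n, k, h⟩
  have h1 := congrArg Complex.im h
  have h2 : (x + τ / 2 : ℂ).im = τ.im / 2 := by simp
  have h3 : (n * τ + k : ℂ).im = n * τ.im := by simp
  rw [h2, h3] at h1
  have h4 : (2 * n : ℝ) = 1 := by
    apply mul_right_cancel₀ hτ.ne'; linarith
  have h5 : (2 * n : ℤ) = 1 := by exact_mod_cast h4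
  omega

/-- The product `z^{1/2} χ` of the character with a half-integral power of `z`, which is a
function of `z`. Here `s = (ℓ + 1) / 2` and the level is `1 / p`. -/
noncomputable def shiftedCharacter (p : ℕ) (s : ℤ) (τ w : ℂ) : ℂ :=
  nome (w - τ / 8) * weylNumerator s (2 * p + 1) w (p * τ) / thetaJ (nome w) (nome τ)

theorem character_eq (p : ℕ) (r : ℤ) {τ : ℂ} (hτ : 0 < τ.im) (w : ℂ) :
    character p (2 * p + 1) (2 * r + 1) w τ =
      nome (-w / 2) * shiftedCharacter p (r + 1) τ w := by
  rw [character, bigTheta_one_two_sub hτ, show 2 * r + 1 + 1 = 2 * (r + 1) by ring,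
    shiftedCharacter, weylNumerator]
  have h : nome (w - τ / 8) = (nome (-w / 2) * nome (τ / 8 - w / 2))⁻¹ := by
    rw [← nome_add, ← nome_neg]; congr 1; ring
  have hne := nome_ne_zero (-w / 2)
  rw [h]
  generalize nome (-w / 2) = a at hne
  generalize nome (τ / 8 - w / 2) = b
  field_simp

theorem shiftedCharacter_add_one (p : ℕ) (s : ℤ) (τ w : ℂ) :
    shiftedCharacter p s τ (w + 1) = shiftedCharacter p s τ w := by
  have h1 : nome (w + 1 - τ / 8) = nome (w - τ / 8) := by
    rw [add_sub_right_comm, nome_add, nome_one, mul_one]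
  have h2 : nome (w + 1) = nome w := by rw [nome_add, nome_one, mul_one]
  rw [shiftedCharacter, weylNumerator_add_one s (by omega), h1, h2, shiftedCharacter]

/-- The character has the same multiplier under `w ↦ w + 2 p τ` as `z^{-1/2} j(-z; q^{2p})`. -/
theorem shiftedCharacter_add (p : ℕ) (s : ℤ) {τ : ℂ} (hτ : 0 < τ.im) (w : ℂ) :
    shiftedCharacter p s τ (w + 2 * p * τ) = nome (-w) * shiftedCharacter p s τ w := by
  have h1 := weylNumerator_add_two_mul s (show 2 * p + 1 ≠ 0 by omega) w (p * τ)
  have h2 := thetaJ_nome_add_int_mul hτ w (2 * p)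
  rw [Even.neg_one_zpow (even_two_mul _), one_mul] at h2
  push_cast at h1 h2
  rw [← mul_assoc] at h1
  have h3 : nome (w + 2 * p * τ - τ / 8) * nome (-((2 * p + 1) * (p * τ)) - (2 * p + 1) * w) =
      nome (-w) * nome (w - τ / 8) * nome (-(2 * p * w) - 2 * p * (2 * p - 1) / 2 * τ) := by
    rw [← nome_add, ← nome_add, ← nome_add]; congr 1; ring
  have hne := nome_ne_zero (-(2 * p * w) - 2 * p * (2 * p - 1) / 2 * τ)
  generalize nome (-(2 * p * w) - 2 * p * (2 * p - 1) / 2 * τ) = a at *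
  rw [shiftedCharacter, shiftedCharacter, h1, h2, ← mul_assoc, h3]
  generalize nome (w - τ / 8) = b
  generalize nome (-w) = c
  field_simp

theorem differentiableAt_shiftedCharacter {p : ℕ} (hp : 1 ≤ p) (s : ℤ) {τ : ℂ} (hτ : 0 < τ.im)
    {w : ℂ} (hw : w ∉ latticePoints τ) : DifferentiableAt ℂ (shiftedCharacter p s τ) w := by
  unfold shiftedCharacter
  refine DifferentiableAt.div (DifferentiableAt.mul ?_ ?_) ?_ ?_
  · exact (differentiable_nome _).comp w (by fun_prop)
  · exact differentiable_weylNumerator s (by omega) (natCast_mul_im_pos hp hτ) w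
  · exact differentiable_thetaJ_nome hτ w
  · exact thetaJ_ne_zero (norm_nome_lt_one hτ) (nome_ne_zero _) fun n hn => hw ⟨n, hn⟩

/-- The leading coefficient of `shiftedCharacter` at its pole `w = n τ`, with respect to the
local parameter `1 - q^{-n} z`. -/
noncomputable def polarCoeff (p : ℕ) (s : ℤ) (τ : ℂ) (n : ℤ) : ℂ :=
  (-1) ^ n * nome (n * τ - τ / 8 + n * (n - 1) / 2 * τ) *
    weylNumerator s (2 * p + 1) (n * τ) (p * τ) * (qPoch (nome τ) (nome τ) ^ 3)⁻¹

theorem tendsto_shiftedCharacter {p : ℕ} (hp : 1 ≤ p) (s : ℤ) {τ : ℂ} (hτ : 0 < τ.im) (n : ℤ) :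
    Tendsto (fun w => (1 - nome (w - n * τ)) * shiftedCharacter p s τ w) (𝓝[≠] (n * τ))
      (𝓝 (polarCoeff p s τ n)) := by
  have h1 : Continuous fun w => nome (w - τ / 8) * weylNumerator s (2 * p + 1) w (p * τ) :=
    (continuous_nome.comp (by fun_prop)).mul
      (differentiable_weylNumerator s (by omega) (natCast_mul_im_pos hp hτ)).continuous
  have h2 := ((h1.tendsto (n * τ)).mono_left nhdsWithin_le_nhds).mul
    (tendsto_one_sub_div_thetaJ_int_mul hτ n)
  have h3 : polarCoeff p s τ n = nome (n * τ - τ / 8) *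
      weylNumerator s (2 * p + 1) (n * τ) (p * τ) *
      ((-1) ^ n * nome (n * (n - 1) / 2 * τ) * (qPoch (nome τ) (nome τ) ^ 3)⁻¹) := by
    rw [polarCoeff, nome_add]; ring
  rw [h3]
  refine h2.congr fun w => ?_
  rw [shiftedCharacter]; ring

theorem polarCoeff_zero (p : ℕ) (s : ℤ) (τ : ℂ) : polarCoeff p s τ 0 = 0 := by
  simp [polarCoeff, weylNumerator_zero]

theorem polarCoeff_self (p : ℕ) (s : ℤ) (τ : ℂ) : polarCoeff p s τ p = 0 := by
  rw [polarCoeff, Int.cast_natCast, weylNumerator_self s (by omega)]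
  ring

/-- The residues at `q^n` and `q^{-n}` are linked because the numerator is odd in `w`. -/
theorem polarCoeff_neg (p : ℕ) (s : ℤ) (τ : ℂ) (n : ℤ) :
    polarCoeff p s τ (-n) = -nome (-(n * τ)) * polarCoeff p s τ n := by
  have h1 : ((-1 : ℂ)) ^ (-n) = (-1) ^ n := by rw [zpow_neg, ← inv_zpow]; norm_num
  have h2 : nome ((-n : ℤ) * τ - τ / 8 + (-n : ℤ) * ((-n : ℤ) - 1) / 2 * τ) =
      nome (-(n * τ)) * nome (n * τ - τ / 8 + n * (n - 1) / 2 * τ) := by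
    rw [← nome_add]; congr 1; push_cast; ring
  have h3 := weylNumerator_neg s (show 2 * p + 1 ≠ 0 by omega) (n * τ) (p * τ)
  rw [polarCoeff, polarCoeff, h1, h2, Int.cast_neg, neg_mul, h3]
  ring

/-- The combination of Appell sums with poles at `z = q^{p-m}` and `z = q^{m-p}` modulo `q^{2p}`. -/
noncomputable def polarSum (p : ℕ) (τ : ℂ) (m : ℕ) (w : ℂ) : ℂ :=
  nome ((m - p) * τ) *
      appellSum (nome ((m - p) * τ)) (nome (2 * p * τ - w)) (nome (2 * p * τ)) +
    appellSum (nome ((m + p) * τ)) (nome w) (nome (2 * p * τ))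

theorem polarSum_add_one (p : ℕ) (τ : ℂ) (m : ℕ) (w : ℂ) :
    polarSum p τ m (w + 1) = polarSum p τ m w := by
  rw [polarSum, polarSum, nome_add w, nome_one, mul_one, ← sub_sub, nome_sub (2 * p * τ - w),
    nome_one, div_one]

theorem polarSum_add (p : ℕ) (τ : ℂ) (m : ℕ) (w : ℂ) :
    polarSum p τ m (w + 2 * p * τ) = nome (-w) * polarSum p τ m w := by
  have h1 := appellSum_mul (nome_ne_zero (2 * p * τ)) (nome_ne_zero w) (nome ((m + p) * τ))
  have h2 := appellSum_mul (nome_ne_zero (2 * p * τ)) (nome_ne_zero (-w)) (nome ((m - p) * τ))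
  rw [← nome_add, ← nome_neg, add_comm (2 * p * τ)] at h1
  rw [← nome_add, ← nome_neg, neg_neg, ← sub_eq_add_neg] at h2
  have h3 : nome (-w) * nome w = 1 := by rw [← nome_add]; simp
  rw [polarSum, polarSum, h1, h2, show 2 * p * τ - (w + 2 * p * τ) = -w by ring]
  linear_combination -(nome ((m - p) * τ) *
    appellSum (nome ((m - p) * τ)) (nome (-w)) (nome (2 * p * τ))) * h3

theorem differentiableAt_appellSum_nome {p : ℕ} (hp : 1 ≤ p) {τ : ℂ} (hτ : 0 < τ.im) {a y : ℂ}
    (h : ∀ k : ℤ, nome (k * (2 * p * τ) + a + y) ≠ 1) :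
    DifferentiableAt ℂ (fun y => appellSum (nome a) y (nome (2 * p * τ))) (nome y) := by
  refine differentiableAt_appellSum (nome_ne_zero _)
    (norm_nome_lt_one (two_mul_natCast_mul_im_pos hp hτ)) (nome_ne_zero _) (nome_ne_zero _)
    fun k => ?_
  rw [← nome_int_mul, ← nome_add, ← nome_add]
  exact h k

/-- The sum with argument `q^{2p} / z` is holomorphic in `w` off the lattice points. -/
theorem differentiableAt_appellSum_reflect {p : ℕ} (hp : 1 ≤ p) {τ : ℂ} (hτ : 0 < τ.im) (m : ℕ)
    {w : ℂ} (hw : w ∉ latticePoints τ) :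
    DifferentiableAt ℂ (fun w => appellSum (nome ((m - p) * τ)) (nome (2 * p * τ - w))
      (nome (2 * p * τ))) w := by
  rw [mem_latticePoints_iff] at hw
  push Not at hw
  refine DifferentiableAt.comp (f := fun w => nome (2 * p * τ - w)) w
    (differentiableAt_appellSum_nome hp hτ fun k h => ?_)
    ((differentiable_nome.comp (show Differentiable ℂ fun w => 2 * p * τ - w by fun_prop)) w)
  obtain ⟨n, hn⟩ := (nome_eq_one_iff _).mp h
  refine hw (k * 2 * p + (m - p) + 2 * p) (-n) ?_
  push_cast
  linear_combination -hn

theorem differentiableAt_appellSum_direct {p : ℕ} (hp : 1 ≤ p) {τ : ℂ} (hτ : 0 < τ.im) (m : ℕ)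
    {w : ℂ} (hw : w ∉ latticePoints τ) :
    DifferentiableAt ℂ (fun w => appellSum (nome ((m + p) * τ)) (nome w) (nome (2 * p * τ))) w := by
  rw [mem_latticePoints_iff] at hw
  push Not at hw
  refine DifferentiableAt.comp w
    (differentiableAt_appellSum_nome hp hτ fun k h => ?_) (differentiable_nome w)
  obtain ⟨n, hn⟩ := (nome_eq_one_iff _).mp h
  refine hw (-(k * 2 * p + (m + p))) n ?_
  push_cast
  linear_combination hn

theorem differentiableAt_polarSum {p : ℕ} (hp : 1 ≤ p) {τ : ℂ} (hτ : 0 < τ.im) (m : ℕ) {w : ℂ}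
    (hw : w ∉ latticePoints τ) : DifferentiableAt ℂ (polarSum p τ m) w :=
  ((differentiableAt_appellSum_reflect hp hτ m hw).const_mul _).add
    (differentiableAt_appellSum_direct hp hτ m hw)

theorem tendsto_nome_nhdsNE (a : ℂ) : Tendsto nome (𝓝[≠] a) (𝓝[≠] (nome a)) := by
  refine tendsto_nhdsWithin_iff.mpr
    ⟨(continuous_nome.tendsto a).mono_left nhdsWithin_le_nhds, ?_⟩
  have hsub : Tendsto (fun w : ℂ => w - a) (𝓝[≠] a) (𝓝[≠] 0) := by
    refine tendsto_nhdsWithin_iff.mpr ⟨?_, ?_⟩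
    · have : Continuous fun w : ℂ => w - a := by fun_prop
      simpa using (this.tendsto a).mono_left nhdsWithin_le_nhds
    · filter_upwards [self_mem_nhdsWithin] with w hw
      exact sub_ne_zero.mpr hw
  filter_upwards [hsub.eventually eventually_nome_ne_one] with w hw h
  apply hw
  rw [nome_sub, show nome w = nome a from h, div_self (nome_ne_zero a)]

theorem tendsto_one_sub_nome_mul {f : ℂ → ℂ} {a : ℂ} (hf : ContinuousAt f a) :
    Tendsto (fun w => (1 - nome (w - a)) * f w) (𝓝[≠] a) (𝓝 0) := by
  have h1 : ContinuousAt (fun w => 1 - nome (w - a)) a :=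
    (continuous_const.sub (continuous_nome.comp (by fun_prop))).continuousAt
  have h2 : Tendsto (fun w => (1 - nome (w - a)) * f w) (𝓝[≠] a) (𝓝 ((1 - nome (a - a)) * f a)) :=
    (h1.mul hf).tendsto.mono_left nhdsWithin_le_nhds
  simpa using h2

theorem eq_of_two_mul_dvd {p k N : ℤ} (h : k * (2 * p) + N = 0) (h0 : 0 < N)
    (h1 : N < 4 * p) : N = 2 * p := by
  have hk : k = -1 := by
    have h2 : k < 0 := by nlinarith
    have h3 : -2 < k := by nlinarith
    omega
  subst hk
  linarith

/-- Among the points `n τ` with `-p < n ≤ p`, which represent the lattice points modulo `2p τ`, this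
Appell sum has a pole only at `n = p - m`. -/
theorem tendsto_appellSum_nome {p : ℕ} {τ : ℂ} (hτ : 0 < τ.im) {m : ℕ} (hm : 1 ≤ m)
    (hmp : m < p) {n : ℤ} (hn : -p < n) (hnp : n ≤ p) :
    Tendsto (fun w => (1 - nome (w - n * τ)) *
      appellSum (nome ((m + p) * τ)) (nome w) (nome (2 * p * τ))) (𝓝[≠] (n * τ))
      (𝓝 (if n = p - m then 1 else 0)) := by
  have hp : 1 ≤ p := by omega
  split_ifs with h
  · have hpole : nome ((m + p) * τ) * nome (n * τ) = nome (2 * p * τ) := by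
      rw [← nome_add, h]; congr 1; push_cast; ring
    have key := (tendsto_mul_appellSum (nome_ne_zero _)
      (norm_nome_lt_one (two_mul_natCast_mul_im_pos hp hτ)) (nome_ne_zero _) hpole).comp
      (tendsto_nome_nhdsNE (n * τ))
    refine key.congr fun w => ?_
    rw [Function.comp_apply, ← nome_neg, ← nome_add, ← nome_add]
    congr 4
    rw [h]; push_cast; ring
  · refine tendsto_one_sub_nome_mul (DifferentiableAt.continuousAt (𝕜 := ℂ) ?_)
    refine DifferentiableAt.comp (n * τ : ℂ)
      (differentiableAt_appellSum_nome hp hτ fun k => ?_) (differentiable_nome _)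
    rw [show (k * (2 * p * τ) + (m + p) * τ + n * τ : ℂ) = (k * (2 * p) + (m + p + n) : ℤ) * τ by
      push_cast; ring]
    refine nome_int_mul_ne_one hτ fun h0 => h ?_
    have := eq_of_two_mul_dvd h0 (by omega) (by omega)
    omega

/-- Among the points `n τ` with `-p < n ≤ p`, the reflected Appell sum has a pole only at
`n = m - p`. -/
theorem tendsto_appellSum_nome_sub {p : ℕ} {τ : ℂ} (hτ : 0 < τ.im) {m : ℕ} (hm : 1 ≤ m)
    (hmp : m < p) {n : ℤ} (hn : -p < n) (hnp : n ≤ p) :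
    Tendsto (fun w => (1 - nome (w - n * τ)) *
      appellSum (nome ((m - p) * τ)) (nome (2 * p * τ - w)) (nome (2 * p * τ))) (𝓝[≠] (n * τ))
      (𝓝 (if n = m - p then -1 else 0)) := by
  have hp : 1 ≤ p := by omega
  have hrefl : Continuous fun w : ℂ => 2 * p * τ - w := by fun_prop
  split_ifs with h
  · have hpole : nome ((m - p) * τ) * nome (2 * p * τ - n * τ) = nome (2 * p * τ) := by
      rw [← nome_add, h]; congr 1; push_cast; ring
    have hsub : Tendsto (fun w : ℂ => 2 * p * τ - w) (𝓝[≠] (n * τ)) (𝓝[≠] (2 * p * τ - n * τ)) := by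
      refine tendsto_nhdsWithin_iff.mpr ⟨(hrefl.tendsto _).mono_left nhdsWithin_le_nhds, ?_⟩
      filter_upwards [self_mem_nhdsWithin] with w hw h
      exact hw (sub_right_injective h)
    have key := (tendsto_mul_appellSum (nome_ne_zero _)
      (norm_nome_lt_one (two_mul_natCast_mul_im_pos hp hτ)) (nome_ne_zero _) hpole).comp
      ((tendsto_nome_nhdsNE _).comp hsub)
    have hunit : Tendsto (fun w => -nome (w - n * τ)) (𝓝[≠] (n * τ)) (𝓝 (-1)) := by
      have : Continuous fun w => -nome (w - n * τ) := (continuous_nome.comp (by fun_prop)).neg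
      simpa using (this.tendsto (n * τ)).mono_left nhdsWithin_le_nhds
    rw [show (-1 : ℂ) = -1 * 1 by ring]
    refine (hunit.mul key).congr fun w => ?_
    rw [Function.comp_apply, Function.comp_apply, ← nome_neg, ← nome_add, ← nome_add,
      show -(2 * p * τ) + (m - p) * τ + (2 * p * τ - w) = -(w - n * τ) by rw [h]; push_cast; ring,
      ← mul_assoc]
    congr 1
    have : nome (w - n * τ) * nome (-(w - n * τ)) = 1 := by rw [← nome_add]; simp
    linear_combination this
  · refine tendsto_one_sub_nome_mul (DifferentiableAt.continuousAt (𝕜 := ℂ) ?_)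
    refine DifferentiableAt.comp (f := fun w => nome (2 * p * τ - w)) (n * τ : ℂ)
      (differentiableAt_appellSum_nome hp hτ fun k => ?_)
      ((differentiable_nome.comp (show Differentiable ℂ fun w => 2 * p * τ - w by fun_prop)) _)
    rw [show (k * (2 * p * τ) + (m - p) * τ + (2 * p * τ - n * τ) : ℂ) =
      (k * (2 * p) + (m + p - n) : ℤ) * τ by push_cast; ring]
    refine nome_int_mul_ne_one hτ fun h0 => h ?_
    rcases eq_or_lt_of_le (show 0 ≤ (m + p - n : ℤ) by omega) with h2 | h2
    · omega
    have := eq_of_two_mul_dvd h0 h2 (by omega)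
    omega

/-! ### The polar-finite decomposition -/

theorem thetaJ_neg_nome_add_one (w Q : ℂ) : thetaJ (-nome (w + 1)) Q = thetaJ (-nome w) Q := by
  rw [nome_add, nome_one, mul_one]

theorem thetaJ_neg_nome_add {τ : ℂ} (hτ : 0 < τ.im) (w : ℂ) :
    thetaJ (-nome (w + τ)) (nome τ) = nome (-w) * thetaJ (-nome w) (nome τ) := by
  have h : -nome (-(w + 1 / 2)) = nome (-w) := by
    rw [show -w = -(w + 1 / 2) + 1 / 2 by ring, nome_add_half]
  rw [← nome_add_half, ← nome_add_half, add_right_comm, thetaJ_nome_add hτ, h]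

theorem differentiable_thetaJ_neg_nome {τ : ℂ} (hτ : 0 < τ.im) :
    Differentiable ℂ fun w => thetaJ (-nome w) (nome τ) := by
  simp_rw [← nome_add_half]
  exact (differentiable_thetaJ_nome hτ).comp (by fun_prop)

theorem integral_thetaJ_neg_nome {τ : ℂ} (hτ : 0 < τ.im) (w : ℂ) :
    ∫ x in (0 : ℝ)..1, thetaJ (-nome (x + w)) (nome τ) = 1 := by
  simp_rw [← nome_add_half, thetaJ_nome hτ, add_sub_assoc, add_assoc]
  exact integral_jacobiTheta₂ _ hτ

theorem continuous_comp_add_half {τ : ℂ} (hτ : 0 < τ.im) {f : ℂ → ℂ}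
    (hf : ∀ w ∉ latticePoints τ, DifferentiableAt ℂ f w) :
    Continuous fun x : ℝ => f (x + τ / 2) := by
  refine continuous_iff_continuousAt.mpr fun x => ?_
  have h1 := (hf _ (add_half_notMem_latticePoints hτ x)).continuousAt
  exact ContinuousAt.comp (f := fun x : ℝ => (x + τ / 2 : ℂ)) h1 (by fun_prop)

/-- Both Appell sums are evaluated on circles that separate their poles of positive index from the
others, which is where `1 ≤ m < p` enters. -/
theorem integral_polarSum {p : ℕ} {τ : ℂ} (hτ : 0 < τ.im) {m : ℕ} (hm : 1 ≤ m) (hmp : m < p) :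
    ∫ x in (0 : ℝ)..1, polarSum p τ m (x + τ / 2) = 0 := by
  have hp : 1 ≤ p := by omega
  have hQ := norm_nome_lt_one (two_mul_natCast_mul_im_pos hp hτ)
  have hm' : (1 : ℝ) ≤ m := by exact_mod_cast hm
  have hmp' : (m : ℝ) + 1 ≤ p := by exact_mod_cast hmp
  have hnorm : ∀ (a : ℝ) (v : ℂ), v = a * τ → 0 < a → a < 2 * p →
      ‖nome v‖ < 1 ∧ ‖nome (2 * p * τ)‖ < ‖nome v‖ := by
    rintro a v rfl h0 h1
    have h2 := norm_nome_mul_lt hτ h0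
    have h3 := norm_nome_mul_lt hτ h1
    push_cast at h2 h3
    rw [zero_mul, nome_zero, norm_one] at h2
    exact ⟨h2, h3⟩
  have h1 : ∫ x in (0 : ℝ)..1, appellSum (nome ((m - p) * τ)) (nome (2 * p * τ - (x + τ / 2)))
      (nome (2 * p * τ)) = 0 := by
    obtain ⟨ha, hb⟩ := hnorm (m + p - 1 / 2) ((m - p) * τ + (2 * p * τ - τ / 2))
      (by push_cast; ring) (by linarith) (by linarith)
    rw [nome_add] at ha hb
    have := integral_appellSum_eq_zero (ε := -1) (by norm_num) (nome_ne_zero _) hQ ha hb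
    convert this using 4
    rw [← nome_add]; congr 1; push_cast; ring
  have h2 : ∫ x in (0 : ℝ)..1, appellSum (nome ((m + p) * τ)) (nome (x + τ / 2))
      (nome (2 * p * τ)) = 0 := by
    obtain ⟨ha, hb⟩ := hnorm (m + p + 1 / 2) ((m + p) * τ + τ / 2)
      (by push_cast; ring) (by linarith) (by linarith)
    rw [nome_add] at ha hb
    have := integral_appellSum_eq_zero (ε := 1) (by norm_num) (nome_ne_zero _) hQ ha hb
    convert this using 4
    rw [← nome_add]; congr 1; push_cast; ring
  have hc1 := continuous_comp_add_half hτ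
    (fun w hw => (differentiableAt_appellSum_reflect hp hτ m hw).const_mul (nome ((m - p) * τ)))
  have hc2 := continuous_comp_add_half hτ
    (fun w hw => differentiableAt_appellSum_direct hp hτ m hw)
  unfold polarSum
  rw [intervalIntegral.integral_add (hc1.intervalIntegrable _ _) (hc2.intervalIntegrable _ _),
    intervalIntegral.integral_const_mul, h1, h2, mul_zero, add_zero]

/-- The difference of the two sides of the polar-finite decomposition, where `a` is the
coefficient of the finite part. -/
noncomputable def polarDefect (p : ℕ) (s : ℤ) (τ a w : ℂ) : ℂ :=
  shiftedCharacter p s τ w - a * thetaJ (-nome w) (nome (2 * p * τ)) -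
    ∑ m ∈ Finset.Ico 1 p, polarCoeff p s τ (p - m) * polarSum p τ m w

theorem polarDefect_add_one {p : ℕ} (s : ℤ) (τ a w : ℂ) :
    polarDefect p s τ a (w + 1) = polarDefect p s τ a w := by
  simp_rw [polarDefect, shiftedCharacter_add_one, thetaJ_neg_nome_add_one, polarSum_add_one]

theorem polarDefect_add {p : ℕ} (hp : 1 ≤ p) (s : ℤ) {τ : ℂ} (hτ : 0 < τ.im) (a w : ℂ) :
    polarDefect p s τ a (w + 2 * p * τ) = nome (-w) * polarDefect p s τ a w := by
  simp_rw [polarDefect, shiftedCharacter_add p s hτ, polarSum_add,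
    thetaJ_neg_nome_add (two_mul_natCast_mul_im_pos hp hτ), mul_sub, Finset.mul_sum]
  congr 1
  · ring
  · exact Finset.sum_congr rfl fun m _ => by ring

theorem differentiableAt_polarDefect {p : ℕ} (hp : 1 ≤ p) (s : ℤ) {τ : ℂ} (hτ : 0 < τ.im) (a : ℂ)
    {w : ℂ} (hw : w ∉ latticePoints τ) : DifferentiableAt ℂ (polarDefect p s τ a) w := by
  unfold polarDefect
  refine ((differentiableAt_shiftedCharacter hp s hτ hw).sub
    ((differentiable_thetaJ_neg_nome (two_mul_natCast_mul_im_pos hp hτ) w).const_mul a)).sub ?_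
  exact DifferentiableAt.fun_sum fun m _ => (differentiableAt_polarSum hp hτ m hw).const_mul _

theorem tendsto_polarSum {p : ℕ} {τ : ℂ} (hτ : 0 < τ.im) {m : ℕ} (hm : 1 ≤ m)
    (hmp : m < p) {n : ℤ} (hn : -p < n) (hnp : n ≤ p) :
    Tendsto (fun w => (1 - nome (w - n * τ)) * polarSum p τ m w) (𝓝[≠] (n * τ))
      (𝓝 (nome ((m - p) * τ) * (if n = m - p then -1 else 0) + if n = p - m then 1 else 0)) := by
  refine (((tendsto_appellSum_nome_sub hτ hm hmp hn hnp).const_mul (nome ((m - p) * τ))).add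
    (tendsto_appellSum_nome hτ hm hmp hn hnp)).congr fun w => ?_
  rw [polarSum]; ring

/-- The residues of the Appell sums add up to those of the character. -/
theorem sum_polarCoeff {p : ℕ} (s : ℤ) (τ : ℂ) {n : ℤ} (hn : -p < n) (hnp : n ≤ p) :
    ∑ m ∈ Finset.Ico 1 p, polarCoeff p s τ (p - m) *
      (nome ((m - p) * τ) * (if n = m - p then -1 else 0) + if n = p - m then 1 else 0) =
    polarCoeff p s τ n := by
  rcases lt_trichotomy n 0 with h | h | h
  · rw [Finset.sum_eq_single_of_mem (p + n).toNat (by rw [Finset.mem_Ico]; omega)]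
    · have h1 : ((p + n).toNat : ℤ) = p + n := by omega
      have h2 : (((p + n).toNat : ℕ) : ℂ) = p + n := by
        exact_mod_cast congrArg (Int.cast : ℤ → ℂ) h1
      rw [h1, h2, if_pos (by ring), if_neg (by omega), show (p - (p + n) : ℤ) = -n by ring,
        polarCoeff_neg, add_sub_cancel_left]
      have : nome (-(n * τ)) * nome (n * τ) = 1 := by rw [← nome_add]; simp
      linear_combination polarCoeff p s τ n * this
    · intro m hm hne
      rw [Finset.mem_Ico] at hm
      rw [if_neg (by omega), if_neg (by omega)]; ring
  · rw [h, polarCoeff_zero]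
    refine Finset.sum_eq_zero fun m hm => ?_
    rw [Finset.mem_Ico] at hm
    rw [if_neg (by omega), if_neg (by omega)]; ring
  · rcases eq_or_lt_of_le hnp with h' | h'
    · rw [h', polarCoeff_self]
      refine Finset.sum_eq_zero fun m hm => ?_
      rw [Finset.mem_Ico] at hm
      rw [if_neg (by omega), if_neg (by omega)]; ring
    · rw [Finset.sum_eq_single_of_mem (p - n).toNat (by rw [Finset.mem_Ico]; omega)]
      · have h1 : ((p - n).toNat : ℤ) = p - n := by omega
        rw [h1, if_neg (by omega), if_pos (by omega), show (p - (p - n) : ℤ) = n by ring]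
        ring
      · intro m hm hne
        rw [Finset.mem_Ico] at hm
        rw [if_neg (by omega), if_neg (by omega)]; ring

/-- The residues of the defect vanish. -/
theorem tendsto_polarDefect {p : ℕ} (hp : 1 ≤ p) (s : ℤ) {τ : ℂ} (hτ : 0 < τ.im) (a : ℂ) {n : ℤ}
    (hn : -p < n) (hnp : n ≤ p) :
    Tendsto (fun w => (1 - nome (w - n * τ)) * polarDefect p s τ a w) (𝓝[≠] (n * τ)) (𝓝 0) := by
  have h1 := tendsto_shiftedCharacter hp s hτ n
  have h2 := tendsto_one_sub_nome_mul (a := n * τ)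
    ((differentiable_thetaJ_neg_nome (two_mul_natCast_mul_im_pos hp hτ)).continuous.const_mul
      a).continuousAt
  have h3 : Tendsto (fun w => ∑ m ∈ Finset.Ico 1 p, polarCoeff p s τ (p - m) *
      ((1 - nome (w - n * τ)) * polarSum p τ m w)) (𝓝[≠] (n * τ)) (𝓝 (polarCoeff p s τ n)) := by
    rw [← sum_polarCoeff s τ hn hnp]
    refine tendsto_finsetSum _ fun m hm => ?_
    rw [Finset.mem_Ico] at hm
    exact (tendsto_polarSum hτ hm.1 hm.2 hn hnp).const_mul _
  have h4 := (h1.sub h2).sub h3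
  rw [sub_zero, sub_self] at h4
  refine h4.congr fun w => ?_
  rw [polarDefect, mul_sub, mul_sub, Finset.mul_sum]
  congr 1
  exact Finset.sum_congr rfl fun m _ => by ring

theorem tendsto_sub_mul_of_tendsto_one_sub_nome_mul {G : ℂ → ℂ} {a : ℂ}
    (h : Tendsto (fun w => (1 - nome (w - a)) * G w) (𝓝[≠] a) (𝓝 0)) :
    Tendsto (fun w => (w - a) * G w) (𝓝[≠] a) (𝓝 0) := by
  have hd : HasDerivAt (fun w => 1 - nome (w - a)) (-(2 * Real.pi * I)) a := by
    unfold nome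
    have h1 : HasDerivAt (fun w : ℂ => 2 * Real.pi * I * (w - a)) (2 * Real.pi * I) a := by
      simpa using ((hasDerivAt_id a).sub_const a).const_mul (2 * Real.pi * I : ℂ)
    simpa using h1.cexp.const_sub 1
  have h2 := hd.tendsto_slope.inv₀ (neg_ne_zero.mpr Complex.two_pi_I_ne_zero)
  have h3 := h2.mul h
  rw [mul_zero] at h3
  refine h3.congr' ?_
  filter_upwards [self_mem_nhdsWithin,
    (tendsto_nome_nhdsNE a).eventually self_mem_nhdsWithin] with w hw hne
  have hne' : 1 - nome (w - a) ≠ 0 := by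
    intro h0
    apply hne
    rw [nome_sub, sub_eq_zero, eq_comm, div_eq_one_iff_eq (nome_ne_zero a)] at h0
    exact h0
  rw [slope_def_field, sub_self, nome_zero, sub_self, sub_zero, inv_div]
  field_simp

/-- A quasi-period transports the vanishing of the residue from `a` to `a + σ`. -/
theorem tendsto_sub_mul_add {G e : ℂ → ℂ} {σ a : ℂ} (he : Continuous e)
    (hG : ∀ w, G (w + σ) = e w * G w)
    (h : Tendsto (fun w => (w - a) * G w) (𝓝[≠] a) (𝓝 0)) :
    Tendsto (fun w => (w - (a + σ)) * G w) (𝓝[≠] (a + σ)) (𝓝 0) := by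
  have hsub : Tendsto (fun w : ℂ => w - σ) (𝓝[≠] (a + σ)) (𝓝[≠] a) := by
    refine tendsto_nhdsWithin_iff.mpr ⟨?_, ?_⟩
    · have : Continuous fun w : ℂ => w - σ := by fun_prop
      simpa using (this.tendsto (a + σ)).mono_left nhdsWithin_le_nhds
    · filter_upwards [self_mem_nhdsWithin] with w hw h
      exact hw (by rw [← show w - σ = a from h]; exact (sub_add_cancel w σ).symm)
  have h1 := (((he.tendsto a).mono_left nhdsWithin_le_nhds).mul h).comp hsub
  rw [mul_zero] at h1
  refine h1.congr fun w => ?_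
  have := hG (w - σ)
  rw [sub_add_cancel] at this
  rw [Function.comp_apply, this]
  ring

theorem tendsto_sub_mul_add_int_mul {G e e' : ℂ → ℂ} {σ a : ℂ} (he : Continuous e)
    (he' : Continuous e') (hG : ∀ w, G (w + σ) = e w * G w) (hG' : ∀ w, G (w + -σ) = e' w * G w)
    (h : Tendsto (fun w => (w - a) * G w) (𝓝[≠] a) (𝓝 0)) (j : ℤ) :
    Tendsto (fun w => (w - (a + j * σ)) * G w) (𝓝[≠] (a + j * σ)) (𝓝 0) := by
  induction j using Int.induction_on with
  | zero => simpa using h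
  | succ j ih =>
    have := tendsto_sub_mul_add he hG ih
    rwa [show a + (j : ℤ) * σ + σ = a + ((j + 1 : ℤ) : ℂ) * σ by push_cast; ring] at this
  | pred j ih =>
    have := tendsto_sub_mul_add he' hG' ih
    rwa [show a + (-j : ℤ) * σ + -σ = a + ((-j - 1 : ℤ) : ℂ) * σ by push_cast; ring] at this

theorem tendsto_sub_mul_polarDefect {p : ℕ} (hp : 1 ≤ p) (s : ℤ) {τ : ℂ} (hτ : 0 < τ.im) (a : ℂ)
    {w₀ : ℂ} (hw : w₀ ∈ latticePoints τ) :
    Tendsto (fun w => (w - w₀) * polarDefect p s τ a w) (𝓝[≠] w₀) (𝓝 0) := by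
  obtain ⟨n, k, rfl⟩ := mem_latticePoints_iff.mp hw
  -- The class of `n` modulo `2p` has a representative `i - p + 1` with `0 ≤ i < 2p`.
  set i := (n + p - 1) % (2 * p) with hi
  set j := (n + p - 1) / (2 * p) with hj
  have hij : 2 * p * j + i = n + p - 1 := Int.mul_ediv_add_emod _ _
  have hi0 : 0 ≤ i := Int.emod_nonneg _ (by omega)
  have hip : i < 2 * p := Int.emod_lt_of_pos _ (by omega)
  have h1 := tendsto_sub_mul_of_tendsto_one_sub_nome_mul
    (tendsto_polarDefect hp s hτ a (n := i - p + 1) (by omega) (by omega))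
  have h2 := tendsto_sub_mul_add_int_mul (σ := 2 * p * τ) (e := fun w => nome (-w))
    (e' := fun w => nome (w - 2 * p * τ)) (continuous_nome.comp (by fun_prop))
    (continuous_nome.comp (by fun_prop)) (polarDefect_add hp s hτ a) (fun w => ?_) h1 j
  · have h3 := tendsto_sub_mul_add_int_mul (σ := 1) (e := fun _ => 1) (e' := fun _ => 1)
      continuous_const continuous_const (fun w => by rw [polarDefect_add_one, one_mul])
      (fun w => by
        rw [one_mul, ← polarDefect_add_one s τ a (w + -1), neg_add_cancel_right]) h2 k
    have hn : (n : ℂ) = 2 * p * j + i - p + 1 := by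
      have := congrArg (Int.cast : ℤ → ℂ) hij
      push_cast at this
      linear_combination -this
    rwa [show (i - p + 1 : ℤ) * τ + j * (2 * p * τ) + k * 1 = n * τ + k by
      rw [hn]; push_cast; ring] at h3
  · have h4 := polarDefect_add hp s hτ a (w + -(2 * p * τ))
    have h5 : nome (w - 2 * p * τ) * nome (-(w + -(2 * p * τ))) = 1 := by
      rw [← nome_add, ← nome_zero]; congr 1; ring
    rw [neg_add_cancel_right] at h4
    rw [h4]
    linear_combination -polarDefect p s τ a (w + -(2 * p * τ)) * h5

theorem eventually_notMem_latticePoints {τ : ℂ} (hτ : 0 < τ.im) (w₀ : ℂ) :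
    ∀ᶠ w in 𝓝[≠] w₀, w ∉ latticePoints τ := by
  have hzero : ∀ w ∈ latticePoints τ, thetaJ (nome w) (nome τ) = 0 := by
    rintro w ⟨n, hn⟩
    have h1 := thetaJ_nome_add_int_mul hτ 0 n
    have h2 : thetaJ (nome 0) (nome τ) = 0 := by
      rw [thetaJ, qPoch_eq_one_sub_mul (norm_nome_lt_one hτ), nome_zero]; ring
    rwa [h2, mul_zero, zero_add, nome_int_mul, ← hn] at h1
  have han : AnalyticOnNhd ℂ (fun w => thetaJ (nome w) (nome τ)) Set.univ := fun w _ =>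
    (differentiable_thetaJ_nome hτ).analyticAt w
  by_contra hcon
  rw [not_eventually] at hcon
  have h := han.eqOn_zero_of_preconnected_of_frequently_eq_zero isPreconnected_univ
    (Set.mem_univ w₀) (hcon.mono fun w hw => hzero w (not_not.mp hw)) (Set.mem_univ (τ / 2))
  refine thetaJ_ne_zero (norm_nome_lt_one hτ) (nome_ne_zero _) (fun n hn => ?_) h
  exact add_half_notMem_latticePoints hτ 0 ⟨n, by simpa using hn⟩

theorem dense_compl_latticePoints {τ : ℂ} (hτ : 0 < τ.im) : Dense (latticePoints τ)ᶜ := fun w =>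
  mem_closure_iff_frequently.mpr
    ((eventually_notMem_latticePoints hτ w).frequently.filter_mono nhdsWithin_le_nhds)

theorem add_notMem_latticePoints {τ w : ℂ} (hw : w ∉ latticePoints τ) (n k : ℤ) :
    w + (n * τ + k) ∉ latticePoints τ := by
  rw [mem_latticePoints_iff] at hw ⊢
  rintro ⟨n', k', h⟩
  refine hw ⟨n' - n, k' - k, ?_⟩
  push_cast
  linear_combination h

/-- The polar-finite decomposition of the character of level `1 / p`. -/
theorem shiftedCharacter_eq {p : ℕ} (hp : 1 ≤ p) (s : ℤ) {τ : ℂ} (hτ : 0 < τ.im) {w : ℂ}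
    (hw : w ∉ latticePoints τ) :
    shiftedCharacter p s τ w =
      (∫ x in (0 : ℝ)..1, shiftedCharacter p s τ (x + τ / 2)) *
        thetaJ (-nome w) (nome (2 * p * τ)) +
      ∑ m ∈ Finset.Ico 1 p, polarCoeff p s τ (p - m) * polarSum p τ m w := by
  set a := ∫ x in (0 : ℝ)..1, shiftedCharacter p s τ (x + τ / 2) with ha
  obtain ⟨g, hg, hgG⟩ := exists_differentiable_eq_of_removable
    (fun w hw => differentiableAt_polarDefect hp s hτ a hw) (eventually_notMem_latticePoints hτ)
    (fun w hw => tendsto_sub_mul_polarDefect hp s hτ a hw)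
  have hL := dense_compl_latticePoints hτ
  have hg1 : ∀ w, g (w + 1) = g w := congrFun <| Continuous.ext_on hL
    (hg.continuous.comp (by fun_prop)) hg.continuous fun w hw => by
      have := add_notMem_latticePoints hw 0 1
      rw [Int.cast_zero, zero_mul, zero_add, Int.cast_one] at this
      change g (w + 1) = g w
      rw [hgG _ this, hgG _ hw, polarDefect_add_one]
  have hg2 : ∀ w, g (w + 2 * p * τ) = nome (-w) * g w := congrFun <| Continuous.ext_on hL
    (hg.continuous.comp (by fun_prop))
    ((continuous_nome.comp continuous_neg).mul hg.continuous) fun w hw => by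
      have := add_notMem_latticePoints hw (2 * p) 0
      push_cast at this
      rw [add_zero] at this
      change g (w + 2 * p * τ) = nome (-w) * g w
      rw [hgG _ this, hgG _ hw, polarDefect_add hp s hτ]
  have hg0 : ∫ x in (0 : ℝ)..1, g (x + τ / 2) = 0 := by
    simp_rw [hgG _ (add_half_notMem_latticePoints hτ _)]
    have hc1 := (continuous_comp_add_half hτ fun w hw =>
      differentiableAt_shiftedCharacter hp s hτ hw).intervalIntegrable
        (μ := MeasureTheory.volume) 0 1
    have hQ := two_mul_natCast_mul_im_pos hp hτ
    have hc2 := (continuous_comp_add_half hτ fun w _ =>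
      ((differentiable_thetaJ_neg_nome hQ) w).const_mul a).intervalIntegrable
        (μ := MeasureTheory.volume) 0 1
    have hc3 : ∀ m : ℕ, Continuous fun x : ℝ =>
        polarCoeff p s τ (p - m) * polarSum p τ m (x + τ / 2) := fun m =>
      continuous_comp_add_half hτ fun w hw => (differentiableAt_polarSum hp hτ m hw).const_mul _
    have hc4 : Continuous fun x : ℝ =>
        ∑ m ∈ Finset.Ico 1 p, polarCoeff p s τ (p - m) * polarSum p τ m (x + τ / 2) :=
      continuous_finsetSum _ fun m _ => hc3 m
    unfold polarDefect
    rw [intervalIntegral.integral_sub (hc1.sub hc2) (hc4.intervalIntegrable 0 1),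
      intervalIntegral.integral_sub hc1 hc2, intervalIntegral.integral_const_mul,
      integral_thetaJ_neg_nome hQ, mul_one, ← ha, sub_self,
      intervalIntegral.integral_finsetSum fun m _ => (hc3 m).intervalIntegrable 0 1, zero_sub,
      neg_eq_zero]
    refine Finset.sum_eq_zero fun m hm => ?_
    rw [Finset.mem_Ico] at hm
    rw [intervalIntegral.integral_const_mul, integral_polarSum hτ hm.1 hm.2, mul_zero]
  have h := eq_zero_of_quasiperiodic hg hg1 hg2 (τ / 2) hg0 w
  rw [hgG w hw, polarDefect] at h
  linear_combination h

/-! ### String functions and residues in terms of theta functions -/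

/-- For `m = 1` the power of `z` in the integral of the string function is the one that turns the
character into `shiftedCharacter`. -/
theorem stringFunction_one_eq {p : ℕ} (hp : 1 ≤ p) (r : ℤ) {τ : ℂ} (hτ : 0 < τ.im) :
    ePow τ (p / 4) * stringFunction p (2 * p + 1) 1 (2 * r + 1) τ =
      ∫ x in (0 : ℝ)..1, shiftedCharacter p (r + 1) τ (x + τ / 2) := by
  have hp' : (p : ℂ) ≠ 0 := by exact_mod_cast (show p ≠ 0 by omega)
  have hlevel : level p (2 * p + 1) = 1 / p := by
    rw [level]; push_cast; field_simp; ring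
  rw [stringFunction, hlevel, ← mul_assoc, ← ePow_add,
    show ((p : ℂ) / 4 + -(((1 : ℤ) : ℂ) ^ 2 / (4 * (1 / p)))) = 0 by push_cast; field_simp; ring,
    ePow_zero, one_mul]
  congr 1
  ext x
  have h : nome (-(x + τ / 2) / 2) * nome ((1 : ℤ) / 2 * (x + τ / 2)) = 1 := by
    rw [← nome_add, ← nome_zero]; congr 1; push_cast; ring
  rw [character_eq p r hτ, ePow_eq_nome]
  linear_combination shiftedCharacter p (r + 1) τ (x + τ / 2) * h

/-- The numerator at `z = q^{p-m}`, which determines the residue of the character there. -/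
theorem weylNumerator_int_mul {p : ℕ} (hp : 1 ≤ p) (s : ℤ) {τ : ℂ} (hτ : 0 < τ.im) (m : ℤ) :
    weylNumerator s (2 * p + 1) ((p - m : ℤ) * τ) (p * τ) =
      nome ((s ^ 2 * p / (2 * p + 1) - s * (p - m)) * τ) *
        (thetaJ (-nome ((m * (2 * p + 1) + p * (2 * s)) * τ)) (nome (2 * p * (2 * p + 1) * τ)) -
          nome ((m * (2 * p + 1) - m * (2 * s)) * τ) *
            thetaJ (-nome ((-m * (2 * p + 1) + p * (2 * s)) * τ))
              (nome (2 * p * (2 * p + 1) * τ))) := by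
  have hpτ := natCast_mul_im_pos hp hτ
  have hP : 2 * p + 1 ≠ 0 := by omega
  have hQ := two_mul_mul_im_pos hP hpτ
  have e1 := bigTheta_eq_thetaJ s hP hpτ ((p - m : ℤ) * τ)
  have e2 := bigTheta_eq_thetaJ (-s) hP hpτ ((p - m : ℤ) * τ)
  -- Both theta values have arguments of the form `-nome u`; the second one is inverted.
  set u := (-m * (2 * p + 1) + p * (2 * s)) * τ with hu
  have hinv : thetaJ (-nome (-u)) (nome (2 * ((2 * p + 1 : ℕ) : ℂ) * (p * τ))) =
      nome (-u) * thetaJ (-nome u) (nome (2 * ((2 * p + 1 : ℕ) : ℂ) * (p * τ))) := by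
    have h1 := thetaJ_nome_neg hQ (u + 1 / 2)
    have h2 : -nome (-u) = nome (-(u + 1 / 2)) := by
      rw [show -u = -(u + 1 / 2) + 1 / 2 by ring, nome_add_half, neg_neg]
    rw [nome_add_half, ← h2, neg_neg] at h1
    exact h1
  have hQ' : 2 * ((2 * p + 1 : ℕ) : ℂ) * (p * τ) = 2 * p * (2 * p + 1) * τ := by push_cast; ring
  rw [show ((2 * p + 1 : ℕ) : ℂ) * (p * τ) + 2 * (-s : ℤ) * (p * τ) -
    ((2 * p + 1 : ℕ) : ℂ) * ((p - m : ℤ) * τ) = -u by rw [hu]; push_cast; ring, hinv] at e2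
  rw [show ((2 * p + 1 : ℕ) : ℂ) * (p * τ) + 2 * s * (p * τ) -
    ((2 * p + 1 : ℕ) : ℂ) * ((p - m : ℤ) * τ) = (m * (2 * p + 1) + p * (2 * s)) * τ by
      push_cast; ring] at e1
  have k1 : nome (s ^ 2 / ((2 * p + 1 : ℕ) : ℂ) * (p * τ) - s * ((p - m : ℤ) * τ)) =
      nome ((s ^ 2 * p / (2 * p + 1) - s * (p - m)) * τ) := by
    congr 1; push_cast; field_simp
  have k2 : nome ((-s : ℤ) ^ 2 / ((2 * p + 1 : ℕ) : ℂ) * (p * τ) - (-s : ℤ) * ((p - m : ℤ) * τ)) *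
      nome (-u) = nome ((s ^ 2 * p / (2 * p + 1) - s * (p - m)) * τ) *
        nome ((m * (2 * p + 1) - m * (2 * s)) * τ) := by
    rw [← nome_add, ← nome_add]
    congr 1
    rw [hu]; push_cast; field_simp; ring
  rw [weylNumerator, ← mul_neg, e1, e2, hQ', k1]
  linear_combination -thetaJ (-nome u) (nome (2 * p * (2 * p + 1) * τ)) * k2

end PolarFinite

open PolarFinite in
theorem corollary2p3 (p : ℕ) (hp : 1 ≤ p) (r : ℤ) (τ w : ℂ) (hτ : 0 < τ.im)
    (q z : ℂ) (hq : q = ePow τ 1) (hz : z = ePow w 1)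
    (hz₁ : ∀ n : ℤ, z ≠ q ^ n) (hz₂ : 2 ≤ p → ∀ n : ℤ, z ≠ -q ^ (2 * p * n)) :
    character p (2 * p + 1) (2 * r + 1) w τ =
      ePow w (-1 / 2) * ePow τ (p / 4) * stringFunction p (2 * p + 1) 1 (2 * r + 1) τ
          * thetaJ (-z) (q ^ (2 * p))
        + 1 / qPoch q q ^ 3 * (-1) ^ p
          * ePow τ (-1 / 8 + p * (2 * r + 2) ^ 2 / (4 * (2 * p + 1)))
          * q ^ ((p.choose 2 : ℤ) - p * r) * ePow w (-1 / 2) * thetaJ (-z) (q ^ (2 * p))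
          * ∑ m ∈ Finset.Ico 1 p,
              (-1) ^ m * q ^ (((m + 1).choose 2 : ℤ) + m * (r - p))
              * (thetaJ (-q ^ ((m : ℤ) * (2 * p + 1) + p * (2 * r + 2)))
                    (q ^ (2 * p * (2 * p + 1)))
                  - q ^ ((m : ℤ) * (2 * p + 1) - m * (2 * r + 2))
                    * thetaJ (-q ^ (-(m : ℤ) * (2 * p + 1) + p * (2 * r + 2)))
                        (q ^ (2 * p * (2 * p + 1))))
              * (q ^ ((m : ℤ) - p)
                    * appellM (-q ^ ((m : ℤ) - p)) (-q ^ (2 * p) * z⁻¹) (q ^ (2 * p))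
                  + appellM (-q ^ (m + p)) (-z) (q ^ (2 * p))) := by
  have hqτ : q = nome τ := by rw [hq, ePow_eq_nome, one_mul]
  have hzw : z = nome w := by rw [hz, ePow_eq_nome, one_mul]
  have hpow : ∀ n : ℤ, q ^ n = nome (n * τ) := fun n => by rw [hqτ, nome_int_mul]
  have hQ : q ^ (2 * p) = nome (2 * p * τ) := by
    rw [hqτ, ← nome_nat_mul]; push_cast; rfl
  have hQ2 : q ^ (2 * p * (2 * p + 1)) = nome (2 * p * (2 * p + 1) * τ) := by
    rw [hqτ, ← nome_nat_mul]; push_cast; rfl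
  have hw : w ∉ latticePoints τ := by
    rintro ⟨n, hn⟩
    exact hz₁ n (by rw [hzw, hn, hqτ])
  have hstring := stringFunction_one_eq hp r hτ
  have hdec := shiftedCharacter_eq hp (r + 1) hτ hw
  rw [← hstring] at hdec
  rw [character_eq p r hτ, hdec, mul_add, ePow_eq_nome w, hQ, hzw]
  congr 1
  · rw [show -1 / 2 * w = -w / 2 by ring]; ring
  rw [Finset.mul_sum, Finset.mul_sum]
  refine Finset.sum_congr rfl fun m hm => ?_
  rw [Finset.mem_Ico] at hm
  have hJ : thetaJ (-nome w) (nome (2 * p * τ)) ≠ 0 := by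
    refine thetaJ_ne_zero (norm_nome_lt_one (two_mul_natCast_mul_im_pos hp hτ))
      (neg_ne_zero.mpr (nome_ne_zero w)) fun n hn => hz₂ (by omega) n ?_
    rw [hpow, hzw, neg_eq_iff_eq_neg.mp hn, ← nome_int_mul]
    congr 2; push_cast; ring
  -- The theta function cancels the denominators of the two Appell functions.
  have hsum : thetaJ (-nome w) (nome (2 * p * τ)) * (q ^ ((m : ℤ) - p)
        * appellM (-q ^ ((m : ℤ) - p)) (-nome (2 * p * τ) * (nome w)⁻¹) (nome (2 * p * τ))
      + appellM (-q ^ (m + p)) (-nome w) (nome (2 * p * τ))) = polarSum p τ m w := by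
    have h1 : q ^ ((m : ℤ) - p) = nome ((m - p) * τ) := by rw [hpow]; push_cast; rfl
    have h2 : q ^ (m + p) = nome ((m + p) * τ) := by rw [hqτ, ← nome_nat_mul]; push_cast; rfl
    have h3 : -nome (2 * p * τ) * (nome w)⁻¹ = -nome (2 * p * τ - w) := by
      rw [nome_sub, div_eq_mul_inv, neg_mul]
    have h4 : thetaJ (-nome (2 * p * τ - w)) (nome (2 * p * τ)) =
        thetaJ (-nome w) (nome (2 * p * τ)) := by
      rw [nome_sub, ← div_neg, thetaJ_div_self (nome_ne_zero _)]
    rw [h3, h1, h2, appellM_neg_neg, appellM_neg_neg, h4, polarSum]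
    field_simp
  have hcoeff : polarCoeff p (r + 1) τ (p - m) = 1 / qPoch q q ^ 3 * (-1) ^ p
      * ePow τ (-1 / 8 + p * (2 * r + 2) ^ 2 / (4 * (2 * p + 1)))
      * q ^ ((p.choose 2 : ℤ) - p * r)
      * ((-1) ^ m * q ^ (((m + 1).choose 2 : ℤ) + m * (r - p))
        * (thetaJ (-q ^ ((m : ℤ) * (2 * p + 1) + p * (2 * r + 2))) (q ^ (2 * p * (2 * p + 1)))
            - q ^ ((m : ℤ) * (2 * p + 1) - m * (2 * r + 2))
              * thetaJ (-q ^ (-(m : ℤ) * (2 * p + 1) + p * (2 * r + 2)))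
                  (q ^ (2 * p * (2 * p + 1))))) := by
    have hW := weylNumerator_int_mul hp (r + 1) hτ m
    have hsign : ((-1 : ℂ)) ^ ((p : ℤ) - m) = (-1) ^ p * (-1) ^ m := by
      rw [zpow_sub₀ (by norm_num), zpow_natCast, zpow_natCast, div_eq_mul_inv, ← inv_pow]
      norm_num
    have a1 : nome (((m : ℤ) * (2 * p + 1) + p * (2 * ((r + 1 : ℤ) : ℂ))) * τ) =
        q ^ ((m : ℤ) * (2 * p + 1) + p * (2 * r + 2)) := by
      rw [hpow]; congr 1; push_cast; ring
    have a2 : nome (((m : ℤ) * (2 * p + 1) - (m : ℤ) * (2 * ((r + 1 : ℤ) : ℂ))) * τ) =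
        q ^ ((m : ℤ) * (2 * p + 1) - m * (2 * r + 2)) := by
      rw [hpow]; congr 1; push_cast; ring
    have a3 : nome ((-(m : ℤ) * (2 * p + 1) + p * (2 * ((r + 1 : ℤ) : ℂ))) * τ) =
        q ^ (-(m : ℤ) * (2 * p + 1) + p * (2 * r + 2)) := by
      rw [hpow]; congr 1; push_cast; ring
    rw [a1, a2, a3, ← hQ2] at hW
    have hexp : nome (((p - m : ℤ) : ℂ) * τ - τ / 8 +
          ((p - m : ℤ) : ℂ) * (((p - m : ℤ) : ℂ) - 1) / 2 * τ) *
        nome ((((r + 1 : ℤ) : ℂ) ^ 2 * p / (2 * p + 1) - ((r + 1 : ℤ) : ℂ) * (p - (m : ℤ))) * τ) =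
        ePow τ (-1 / 8 + p * (2 * r + 2) ^ 2 / (4 * (2 * p + 1))) *
          q ^ ((p.choose 2 : ℤ) - p * r) * q ^ (((m + 1).choose 2 : ℤ) + m * (r - p)) := by
      rw [hpow, hpow, ePow_eq_nome, ← nome_add, ← nome_add, ← nome_add]
      congr 1
      rw [choose_two_cast, choose_two_cast]
      push_cast [triangle_cast]
      field_simp
      ring
    rw [polarCoeff, hW, hsign, ← hqτ, one_div]
    generalize thetaJ (-q ^ ((m : ℤ) * (2 * p + 1) + p * (2 * r + 2))) _ = b₁
    generalize thetaJ (-q ^ (-(m : ℤ) * (2 * p + 1) + p * (2 * r + 2))) _ = b₂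
    generalize q ^ ((m : ℤ) * (2 * p + 1) - m * (2 * r + 2)) = b₃
    linear_combination (-1) ^ p * (-1) ^ m * (qPoch q q ^ 3)⁻¹ * (b₁ - b₃ * b₂) * hexp
  rw [hcoeff, ← hsum, hqτ, show -1 / 2 * w = -w / 2 by ring]
  ring
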